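/- Let $p\in\{2,3,5,7\}$, let $\eta(\tau)=q^{1/24}\prod_{n\ge1}(1-q^n)$ with $q=e^{2\pi i\tau}$, $\operatorname{Im}\tau>0$, and put $\psi^{(p)}(\tau)=\bigl(\eta(\tau)/\eta(p\tau)\bigr)^{24/(p-1)}$. For every integer $m\ge1$ there is a unique function of the form $$f_{0,m}^{(p)}=\bigl(\psi^{(p)}\bigr)^m-Q\bigl(\psi^{(p)}\bigr),$$ where $Q\in\mathbb{C}[x]$ is a polynomial of degree less than $m$ with no constant term, which has on the upper half-plane an expansion $$f_{0,m}^{(p)}(\tau)=q^{-m}+\sum_{n=0}^{\infty}a_0^{(p)}(m,n)\,q^n ,$$ and its coefficients $a_0^{(p)}(m,n)$ are integers. Write $m=p^{\alpha}m'$ with $\alpha\ge0$ and $p\nmid m'$. Then for all integers $\beta>\alpha$ and $n\ge1$, $$\begin{array}{rll} a_0^{(2)}(2^{\alpha}m',2^{\beta}n)\equiv0 & \pmod{2^{3(\beta-\alpha)+8}} & \text{if }p=2,\\ a_0^{(3)}(3^{\alpha}m',3^{\beta}n)\equiv0 & \pmod{3^{2(\beta-\alpha)+3}} & \text{if }p=3,\\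 a_0^{(5)}(5^{\alpha}m',5^{\beta}n)\equiv0 & \pmod{5^{(\beta-\alpha)+1}} & \text{if }p=5,\\ a_0^{(7)}(7^{\alpha}m',7^{\beta}n)\equiv0 & \pmod{7^{\beta-\alpha}} & \text{if }p=7. \end{array}$$ -/

import Mathlib

open scoped UpperHalfPlane Polynomial

/-- The nome `q = e^{2πiτ}` of a point `τ` of the upper half-plane. -/
noncomputable def nome (τ : ℍ) : ℂ := Function.Periodic.qParam 1 (τ : ℂ)

/-- The eta quotient `ψ^{(p)}(τ) = (η(τ) / η(pτ))^{24/(p-1)}`. It is used for `p = 2, 3, 5, 7`,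
where the exponent is the integer `24, 12, 6, 4` respectively. -/
noncomputable def psi (p : ℕ) (τ : ℍ) : ℂ :=
  (ModularForm.eta (τ : ℂ) / ModularForm.eta ((p : ℂ) * (τ : ℂ))) ^ (24 / (p - 1))

/-- `f(τ) = q^{-m} + ∑_{n ≥ 0} a(n) q^n` for all `τ` in the upper half-plane. -/
def HasPolarExpansion (m : ℕ) (f : ℍ → ℂ) (a : ℕ → ℂ) : Prop :=
  ∀ τ : ℍ, HasSum (fun n : ℕ => a n * nome τ ^ n) (f τ - nome τ ^ (-(m : ℤ)))

/-- `f` is the function `f_{0,m}^{(p)}`: it has the form `ψ^m - Q(ψ)`, where `ψ = ψ^{(p)}` and `Q`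
is a polynomial of degree less than `m` with no constant term, and `q^{-m}` is the only negative
power of `q` in its expansion. For `m = 0` this says that `f = 1`. -/
def IsBasisElement (p m : ℕ) (f : ℍ → ℂ) : Prop :=
  (∃ Q : ℂ[X], Q.degree < (m : WithBot ℕ) ∧ Q.coeff 0 = 0 ∧
    ∀ τ : ℍ, f τ = psi p τ ^ m - Q.eval (psi p τ)) ∧
  ∃ a : ℕ → ℂ, HasPolarExpansion m f a

/-! ### Power series on the unit disc -/

open Filter Topology
open PowerSeries (coeff)
open Function.Periodic (qParam)

/-! Write Ψ for `etaQuot p` and U_p for the operator keeping the coefficients of q^{pn}. The basis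
functions are polynomials in Ψ, and the congruences come from following U_p on polynomials in Ψ and
in 1/Ψ.

The p + 1 functions p^{12/(p-1)}/Ψ(z) and Ψ((z+j)/p) are permuted by z ↦ z + 1 and z ↦ -1/z
(`conjugate_add_one`, `conjugate_inversion`). A holomorphic symmetric function of them with a limit
at the cusp is therefore constant (`eq_of_levelOne`). This covers the power sums of exponent 0 < k <
p and the product (`sum_etaQuot_pow`, `prod_etaQuot`). Newton's identities turn it into an explicit
equation of degree p for y = Ψ((z+j)/p) (`translate_equation`).

Multiplying that equation by y^m and averaging over j gives a recursion for U_p(Ψ^n): the result is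
an integral polynomial in Ψ plus p^`polarExp` times an integral polynomial without constant term in
p^`scaleExp`/Ψ (`isMixed_heckeU_etaQuot_pow`). Dividing by powers of y instead gives a recursion for
U_p on powers of p^`scaleExp`/Ψ, and here each application gains p^`gainExp`
(`isRegularMultiple_heckeU_scaledInv_pow`).

Now let m = p^α m'. Up to regular terms divisible by p^`polarExp`, each of the first α applications
of U_p divides the order of the pole by p, and the next one leaves only a constant. The remaining β
- α - 1 applications gain p^`gainExp` each, and the expansion of p^`scaleExp`/Ψ supplies a last
factor p^`scaleExp` (`PolarExp.pow_dvd_coeff`). Existence with integral coefficients is triangular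
elimination (`exists_polarExp`); uniqueness holds because a polynomial in Ψ bounded at the cusp is
constant (`eq_of_polarExp`). -/

/-- The power series `a` converges to `F` on the open unit disc. -/
def IsSeries (a : PowerSeries ℂ) (F : ℂ → ℂ) : Prop :=
  ∀ q : ℂ, ‖q‖ < 1 → HasSum (fun n : ℕ => coeff n a * q ^ n) (F q)

namespace IsSeries

variable {a b : PowerSeries ℂ} {F G : ℂ → ℂ}

lemma congr (h : IsSeries a F) (hFG : ∀ q : ℂ, ‖q‖ < 1 → F q = G q) : IsSeries a G :=
  fun q hq => hFG q hq ▸ h q hq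

lemma one : IsSeries 1 (fun _ => 1) := fun q _ => by
  convert hasSum_ite_eq (0 : ℕ) (1 : ℂ) using 2 with n
  rw [PowerSeries.coeff_one]
  split_ifs with h <;> simp [h]

lemma mul (ha : IsSeries a F) (hb : IsSeries b G) : IsSeries (a * b) (fun q => F q * G q) := by
  intro q hq
  have h1 := (ha q hq).summable.norm
  have h2 := (hb q hq).summable.norm
  have key : ∀ n, coeff n (a * b) * q ^ n = ∑ kl ∈ Finset.HasAntidiagonal.antidiagonal n,
      (coeff kl.1 a * q ^ kl.1) * (coeff kl.2 b * q ^ kl.2) := by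
    intro n
    rw [PowerSeries.coeff_mul, Finset.sum_mul]
    refine Finset.sum_congr rfl fun kl hkl => ?_
    rw [← Finset.HasAntidiagonal.mem_antidiagonal.mp hkl, pow_add]
    ring
  show HasSum _ (F q * G q)
  rw [← (ha q hq).tsum_eq, ← (hb q hq).tsum_eq,
    tsum_mul_tsum_eq_tsum_sum_antidiagonal_of_summable_norm h1 h2]
  simp_rw [key]
  exact (summable_norm_sum_mul_antidiagonal_of_summable_norm h1 h2).of_norm.hasSum

lemma pow (ha : IsSeries a F) (k : ℕ) : IsSeries (a ^ k) (fun q => F q ^ k) := by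
  induction k with
  | zero => simpa using one
  | succ k ih => simpa only [pow_succ] using ih.mul ha

lemma expand (ha : IsSeries a F) {p : ℕ} (hp : p ≠ 0) :
    IsSeries (PowerSeries.expand p hp a) (fun q => F (q ^ p)) := by
  intro q hq
  have h := ha (q ^ p) (by rw [norm_pow]; exact pow_lt_one₀ (norm_nonneg _) hq hp)
  rw [← Function.Injective.hasSum_iff (mul_right_injective₀ hp)]
  · convert h using 2 with n
    simp [PowerSeries.coeff_expand_mul, pow_mul]
  · intro n hn
    rw [PowerSeries.coeff_expand_of_not_dvd, zero_mul]
    rintro ⟨c, rfl⟩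
    exact hn ⟨c, rfl⟩

end IsSeries

/-- The point q = 0 is left out of the hypothesis because the nome never vanishes; summability there
is automatic. -/
lemma hasFPowerSeriesOnBall_of_hasSum {c : ℕ → ℂ}
    (h : ∀ q : ℂ, q ≠ 0 → ‖q‖ < 1 → Summable (fun n : ℕ => c n * q ^ n)) :
    HasFPowerSeriesOnBall (fun q => ∑' n, c n * q ^ n) (.ofScalars ℂ c) 0 1 := by
  have hs : ∀ q : ℂ, ‖q‖ < 1 → Summable (fun n : ℕ => c n * q ^ n) := fun q hq => by
    rcases eq_or_ne q 0 with rfl | h0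
    · exact summable_of_ne_finset_zero (s := {0}) fun n hn => by simp_all
    · exact h q h0 hq
  refine ⟨?_, zero_lt_one, ?_⟩
  · refine le_of_forall_lt_imp_le_of_dense fun r hr => ?_
    lift r to NNReal using hr.ne_top
    apply FormalMultilinearSeries.le_radius_of_summable
    have hr1 : (r : ℝ) < 1 := by exact_mod_cast hr
    have := (hs (r : ℂ) (by simpa using hr1)).norm
    simpa [FormalMultilinearSeries.ofScalars_norm, norm_mul, norm_pow] using this
  · intro q hq
    have hq' : ‖q‖ < 1 := by simpa [← ofReal_norm] using hq
    simpa [FormalMultilinearSeries.ofScalars_apply_eq, smul_eq_mul, mul_comm] using (hs q hq').hasSum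

/-- A power series in the nome that vanishes on the upper half-plane is zero. -/
lemma eq_zero_of_hasSum_punctured {c : ℕ → ℂ}
    (h : ∀ q : ℂ, q ≠ 0 → ‖q‖ < 1 → HasSum (fun n : ℕ => c n * q ^ n) 0) : c = 0 := by
  have h1 := hasFPowerSeriesOnBall_of_hasSum (c := c) fun q h0 hq => (h q h0 hq).summable
  have hev : ∀ᶠ q in 𝓝[≠] (0 : ℂ), (fun q => ∑' n, c n * q ^ n) q = 0 := by
    filter_upwards [self_mem_nhdsWithin,
      mem_nhdsWithin_of_mem_nhds (Metric.ball_mem_nhds (0 : ℂ) zero_lt_one)] with q h0 hq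
    exact (h q h0 (by simpa using hq)).tsum_eq
  have hev' : ∀ᶠ q in 𝓝 (0 : ℂ), (fun q => ∑' n, c n * q ^ n) q = 0 :=
    (h1.analyticAt.frequently_zero_iff_eventually_zero).mp hev.frequently
  have h2 := h1.hasFPowerSeriesAt.eq_zero_of_eventually hev'
  funext n
  have h3 := congrArg (fun s => FormalMultilinearSeries.coeff s n) h2
  rw [FormalMultilinearSeries.coeff_ofScalars] at h3
  exact h3

lemma tendsto_of_hasSum {c : ℕ → ℂ} {F : ℂ → ℂ}
    (h : ∀ q : ℂ, q ≠ 0 → ‖q‖ < 1 → HasSum (fun n : ℕ => c n * q ^ n) (F q)) :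
    Tendsto F (𝓝[≠] 0) (𝓝 (c 0)) := by
  have h1 := hasFPowerSeriesOnBall_of_hasSum (c := c) fun q h0 hq => (h q h0 hq).summable
  have h2 : Tendsto (fun q : ℂ => ∑' n, c n * q ^ n) (𝓝 0) (𝓝 (c 0)) := by
    have := h1.hasFPowerSeriesAt.continuousAt.tendsto
    rwa [tsum_eq_single 0 (fun n hn => by simp [hn]), pow_zero, mul_one] at this
  refine (h2.mono_left nhdsWithin_le_nhds).congr' ?_
  filter_upwards [self_mem_nhdsWithin,
      mem_nhdsWithin_of_mem_nhds (Metric.ball_mem_nhds (0 : ℂ) zero_lt_one)] with q h0 hq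
  exact (h q h0 (by simpa using hq)).tsum_eq

lemma IsSeries.unique {a b : PowerSeries ℂ} {F : ℂ → ℂ} (ha : IsSeries a F) (hb : IsSeries b F) :
    a = b := by
  have : (fun n => coeff n a - coeff n b) = 0 := eq_zero_of_hasSum_punctured fun q _ hq => by
    have := (ha q hq).sub (hb q hq)
    simpa only [← sub_mul, sub_self] using this
  ext n
  exact sub_eq_zero.mp (congrFun this n)

/-- The inverse of a nowhere vanishing function with an integral power series with constant
term `1` is again given by an integral power series. -/
lemma IsSeries.inv {a a' : PowerSeries ℤ} {F : ℂ → ℂ} (haa' : a * a' = 1)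
    (ha : IsSeries (a.map (Int.castRingHom ℂ)) F)
    (hd : DifferentiableOn ℂ F (Metric.ball 0 1)) (h0 : ∀ q : ℂ, ‖q‖ < 1 → F q ≠ 0) :
    IsSeries (a'.map (Int.castRingHom ℂ)) (fun q => (F q)⁻¹) := by
  have hinv : DifferentiableOn ℂ (fun q => (F q)⁻¹) (Metric.ball 0 1) :=
    hd.fun_inv fun q hq => h0 q (by simpa using hq)
  obtain ⟨c, hc⟩ : ∃ c : PowerSeries ℂ, IsSeries c (fun q => (F q)⁻¹) := by
    refine ⟨.mk fun n => (n.factorial : ℂ)⁻¹ * iteratedDeriv n (fun q => (F q)⁻¹) 0,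
      fun q hq => ?_⟩
    have := Complex.hasSum_taylorSeries_on_ball (z := q) (r := 1) (c := 0) hinv (mem_ball_zero_iff.mpr hq)
    have key : ∀ n : ℕ, coeff n (PowerSeries.mk fun n => (n.factorial : ℂ)⁻¹ *
        iteratedDeriv n (fun q => (F q)⁻¹) 0) * q ^ n =
        (n.factorial : ℂ)⁻¹ • (q - 0) ^ n • iteratedDeriv n (fun q => (F q)⁻¹) 0 := fun n => by
      simp only [PowerSeries.coeff_mk, sub_zero, smul_eq_mul]
      ring
    simpa only [key] using this
  have h1 : a.map (Int.castRingHom ℂ) * c = 1 :=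
    (((ha.mul hc).congr fun q hq => mul_inv_cancel₀ (h0 q hq))).unique IsSeries.one
  have h2 : a.map (Int.castRingHom ℂ) * a'.map (Int.castRingHom ℂ) = 1 := by
    rw [← map_mul, haa', map_one]
  have : c = a'.map (Int.castRingHom ℂ) := by
    calc c = a'.map (Int.castRingHom ℂ) * (a.map (Int.castRingHom ℂ) * c) := by
          rw [← mul_assoc, mul_comm (PowerSeries.map _ a'), h2, one_mul]
      _ = _ := by rw [h1, mul_one]
  exact this ▸ hc

/-! ### Euler's product and the pentagonal number theorem -/

/-- Euler's product `∏ (1 - q^n)`. -/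
noncomputable def eulerProd (q : ℂ) : ℂ := ∏' n : ℕ, (1 - q ^ (n + 1))

/-- A geometric bound uniform in k, from 1 + t ≤ exp t. It serves both the summability and the
vanishing of the remainder in the pentagonal number theorem. -/
lemma norm_pow_mul_prod_one_sub_le {x : ℂ} (hx : ‖x‖ < 1) (k n : ℕ) :
    ‖x ^ ((k + 1) * n) * ∏ i ∈ Finset.range (n + 1), (1 - x ^ (k + i + 1))‖ ≤
      Real.exp (1 - ‖x‖)⁻¹ * ‖x‖ ^ n := by
  have h0 := norm_nonneg x
  rw [norm_mul, norm_pow, norm_prod, mul_comm]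
  refine mul_le_mul ?_ (pow_le_pow_of_le_one h0 hx.le (Nat.le_mul_of_pos_left n k.succ_pos))
    (by positivity) (by positivity)
  calc ∏ i ∈ Finset.range (n + 1), ‖1 - x ^ (k + i + 1)‖
      ≤ ∏ i ∈ Finset.range (n + 1), Real.exp (‖x‖ ^ i) := by
        refine Finset.prod_le_prod (fun _ _ => norm_nonneg _) fun i _ => ?_
        calc ‖1 - x ^ (k + i + 1)‖ ≤ ‖(1 : ℂ)‖ + ‖x ^ (k + i + 1)‖ := norm_sub_le _ _
          _ = ‖x‖ ^ (k + i + 1) + 1 := by rw [norm_one, norm_pow, add_comm]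
          _ ≤ ‖x‖ ^ i + 1 := by
            gcongr ?_ + 1
            exact pow_le_pow_of_le_one h0 hx.le (by omega)
          _ ≤ Real.exp (‖x‖ ^ i) := Real.add_one_le_exp _
    _ = Real.exp (∑ i ∈ Finset.range (n + 1), ‖x‖ ^ i) := (Real.exp_sum _ _).symm
    _ ≤ Real.exp (1 - ‖x‖)⁻¹ := by
        rw [Real.exp_le_exp, ← tsum_geometric_of_lt_one h0 hx]
        exact (summable_geometric_of_lt_one h0 hx).sum_le_tsum _ fun _ _ => by positivity

lemma summable_pow_pentagonal {x : ℂ} (hx : ‖x‖ < 1) :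
    Summable fun k : ℤ => ((Int.negOnePow k : ℤ) : ℂ) * x ^ pentagonal k := by
  have h := (pentagonal_injective.summable_iff (f := fun n : ℕ => ‖x‖ ^ n * Set.indicator
    (Set.range pentagonal) 1 n) fun n hn => by simp [hn]).mpr
      ((summable_geometric_of_lt_one (norm_nonneg x) hx).of_nonneg_of_le
        (fun n => mul_nonneg (by positivity) (Set.indicator_nonneg (by simp) _))
        fun n => mul_le_of_le_one_right (by positivity) (Set.indicator_le_self' (by simp) n))
  refine .of_norm (h.congr fun k => ?_)
  simp

lemma hasSum_pow_pentagonal_sub {x : ℂ} (hx : ‖x‖ < 1) :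
    HasSum (fun k : ℕ => (-1) ^ k * (x ^ pentagonal (-k) - x ^ pentagonal (k + 1)))
      (∑' k : ℤ, ((Int.negOnePow k : ℤ) : ℂ) * x ^ pentagonal k) := by
  have h := (summable_pow_pentagonal hx).hasSum
  rw [← neg_injective.hasSum_iff (fun x hx => by absurd hx; use -x; simp)] at h
  convert h.nat_add_neg_add_one using 2 with k
  simp_rw [Function.comp_apply, neg_neg, Int.negOnePow_add, Int.negOnePow_neg]
  simp
  ring

lemma eulerProd_eq_tsum {x : ℂ} (hx : ‖x‖ < 1) :
    eulerProd x = ∑' k : ℕ, (-1) ^ k * (x ^ pentagonal (-k) - x ^ pentagonal (k + 1)) := by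
  have h0 := norm_nonneg x
  have hgeo := summable_geometric_of_lt_one h0 hx
  refine Pentagonal.tprod_one_sub_pow (tendsto_pow_atTop_nhds_zero_of_norm_lt_one hx) ?_ ?_ ?_ ?_
  · exact fun k => .of_norm_bounded (hgeo.mul_left _) (norm_pow_mul_prod_one_sub_le hx k)
  · intro k
    simp_rw [sub_eq_add_neg]
    refine multipliable_one_add_of_summable ?_
    simp_rw [norm_neg, norm_pow, add_assoc]
    exact (summable_nat_add_iff (k + 1)).mpr hgeo
  · exact (hasSum_pow_pentagonal_sub hx).summable
  -- The remainder of the recursion carries a power of x with exponent at least k, times a series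
  -- bounded uniformly in k.
  · rw [tendsto_zero_iff_norm_tendsto_zero]
    refine squeeze_zero (fun _ => norm_nonneg _) (g := fun k =>
      ‖x‖ ^ k * (Real.exp (1 - ‖x‖)⁻¹ * (1 - ‖x‖)⁻¹)) (fun k => ?_) ?_
    · rw [norm_mul, norm_mul, norm_pow, norm_pow, norm_neg, norm_one, one_pow, one_mul]
      refine mul_le_mul (pow_le_pow_of_le_one h0 hx.le ?_) ?_ (norm_nonneg _) (by positivity)
      · rw [Nat.le_div_iff_mul_le two_pos]; nlinarith
      · exact tsum_of_norm_bounded ((hasSum_geometric_of_lt_one h0 hx).mul_left _) (norm_pow_mul_prod_one_sub_le hx k)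
    · simpa using (tendsto_pow_atTop_nhds_zero_of_lt_one h0 hx).mul_const
        (Real.exp (1 - ‖x‖)⁻¹ * (1 - ‖x‖)⁻¹)

lemma isSeries_eulerProd : IsSeries
    ((PowerSeries.pentagonalSeries ℤ).map (Int.castRingHom ℂ)) eulerProd := by
  intro q hq
  rw [eulerProd_eq_tsum hq, (hasSum_pow_pentagonal_sub hq).tsum_eq,
    ← pentagonal_injective.hasSum_iff fun n hn => by
      simp [PowerSeries.coeff_pentagonalSeries_eq_zero ℤ hn]]
  refine (summable_pow_pentagonal hq).hasSum.congr_fun fun k => by simp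

lemma differentiableOn_eulerProd : DifferentiableOn ℂ eulerProd (Metric.ball 0 1) :=
  ModularForm.differentiableOn_tprod_one_sub_pow

lemma eulerProd_ne_zero {q : ℂ} (hq : ‖q‖ < 1) : eulerProd q ≠ 0 := by
  simp_rw [eulerProd, sub_eq_add_neg]
  refine tprod_one_add_ne_zero_of_summable (fun n h => ?_) ?_
  · have h1 : q ^ (n + 1) = 1 := by linear_combination -h
    have h2 := pow_lt_one₀ (norm_nonneg q) hq n.succ_ne_zero
    rw [← norm_pow, h1, norm_one] at h2
    exact lt_irrefl _ h2
  · simpa using (summable_nat_add_iff 1).mpr (summable_geometric_of_lt_one (norm_nonneg q) hq)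

/-! ### Initial coefficients of powers of Euler's product -/

/-- The first seven coefficients of an integral power series. -/
def HasJet (a : PowerSeries ℤ) (l : List ℤ) : Prop := ∀ i < 7, coeff i a = l.getD i 0

lemma HasJet.mul {a b : PowerSeries ℤ} {l m r : List ℤ} (ha : HasJet a l) (hb : HasJet b m)
    (h : ∀ i < 7, ∑ k ∈ Finset.range (i + 1), l.getD k 0 * m.getD (i - k) 0 = r.getD i 0) :
    HasJet (a * b) r := by
  intro i hi
  rw [PowerSeries.coeff_mul, Finset.Nat.sum_antidiagonal_eq_sum_range_succ_mk, ← h i hi]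
  refine Finset.sum_congr rfl fun k hk => ?_
  rw [ha k (by have := Finset.mem_range.mp hk; omega), hb (i - k) (by omega)]

lemma HasJet.pow_add {a : PowerSeries ℤ} {i j : ℕ} {l m r : List ℤ} (hi : HasJet (a ^ i) l)
    (hj : HasJet (a ^ j) m)
    (h : ∀ n < 7, ∑ k ∈ Finset.range (n + 1), l.getD k 0 * m.getD (n - k) 0 = r.getD n 0) :
    HasJet (a ^ (i + j)) r :=
  _root_.pow_add a i j ▸ hi.mul hj h

lemma notMem_range_pentagonal {n : ℕ} (hn : n = 3 ∨ n = 4 ∨ n = 6) :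
    n ∉ Set.range pentagonal := by
  rintro ⟨k, hk⟩
  have h1 := two_mul_natCast_pentagonal k
  rw [hk] at h1
  have h2 : -2 ≤ k := by rcases hn with rfl | rfl | rfl <;> push_cast at h1 <;> nlinarith
  have h3 : k ≤ 2 := by rcases hn with rfl | rfl | rfl <;> push_cast at h1 <;> nlinarith
  interval_cases k <;> omega

lemma hasJet_pentagonalSeries : HasJet (PowerSeries.pentagonalSeries ℤ) [1, -1, -1, 0, 0, 1, 0] := by
  have key := PowerSeries.coeff_pentagonalSeries_pentagonal (R := ℤ)
  have hz : ∀ n : ℕ, n = 3 ∨ n = 4 ∨ n = 6 → coeff n (PowerSeries.pentagonalSeries ℤ) = 0 :=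
    fun n hn => PowerSeries.coeff_pentagonalSeries_eq_zero ℤ (notMem_range_pentagonal hn)
  intro i hi
  interval_cases i
  · exact key 0
  · exact key 1
  · exact key (-1)
  · exact hz 3 (by simp)
  · exact hz 4 (by simp)
  · exact key 2
  · exact hz 6 (by simp)

lemma hasJet_pentagonalSeries_pow_1 : HasJet (PowerSeries.pentagonalSeries ℤ ^ 1)
    [1, -1, -1, 0, 0, 1, 0] :=
  (pow_one (PowerSeries.pentagonalSeries ℤ)).symm ▸ hasJet_pentagonalSeries

lemma hasJet_pentagonalSeries_pow_2 : HasJet (PowerSeries.pentagonalSeries ℤ ^ 2)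
    [1, -2, -1, 2, 1, 2, -2] :=
  hasJet_pentagonalSeries_pow_1.pow_add hasJet_pentagonalSeries_pow_1 (by decide)

lemma hasJet_pentagonalSeries_pow_4 : HasJet (PowerSeries.pentagonalSeries ℤ ^ 4)
    [1, -4, 2, 8, -5, -4, -10] :=
  hasJet_pentagonalSeries_pow_2.pow_add hasJet_pentagonalSeries_pow_2 (by decide)

lemma hasJet_pentagonalSeries_pow_6 : HasJet (PowerSeries.pentagonalSeries ℤ ^ 6)
    [1, -6, 9, 10, -30, 0, 11] :=
  hasJet_pentagonalSeries_pow_2.pow_add hasJet_pentagonalSeries_pow_4 (by decide)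

lemma hasJet_pentagonalSeries_pow_8 : HasJet (PowerSeries.pentagonalSeries ℤ ^ 8)
    [1, -8, 20, 0, -70, 64, 56] :=
  hasJet_pentagonalSeries_pow_4.pow_add hasJet_pentagonalSeries_pow_4 (by decide)

lemma hasJet_pentagonalSeries_pow_12 : HasJet (PowerSeries.pentagonalSeries ℤ ^ 12)
    [1, -12, 54, -88, -99, 540, -418] :=
  hasJet_pentagonalSeries_pow_6.pow_add hasJet_pentagonalSeries_pow_6 (by decide)

lemma hasJet_pentagonalSeries_pow_16 : HasJet (PowerSeries.pentagonalSeries ℤ ^ 16)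
    [1, -16, 104, -320, 260, 1248, -3712] :=
  hasJet_pentagonalSeries_pow_8.pow_add hasJet_pentagonalSeries_pow_8 (by decide)

lemma hasJet_pentagonalSeries_pow_18 : HasJet (PowerSeries.pentagonalSeries ℤ ^ 18)
    [1, -18, 135, -510, 765, 1242, -7038] :=
  hasJet_pentagonalSeries_pow_6.pow_add hasJet_pentagonalSeries_pow_12 (by decide)

lemma hasJet_pentagonalSeries_pow_20 : HasJet (PowerSeries.pentagonalSeries ℤ ^ 20)
    [1, -20, 170, -760, 1615, 476, -11210] :=
  hasJet_pentagonalSeries_pow_8.pow_add hasJet_pentagonalSeries_pow_12 (by decide)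

lemma hasJet_pentagonalSeries_pow_24 : HasJet (PowerSeries.pentagonalSeries ℤ ^ 24)
    [1, -24, 252, -1472, 4830, -6048, -16744] :=
  hasJet_pentagonalSeries_pow_12.pow_add hasJet_pentagonalSeries_pow_12 (by decide)

/-! ### The eta quotient: expansion, non-vanishing, Fricke involution -/

/-- The levels for which `X₀(p)` has genus zero and `p - 1` divides `24`. -/
def IsLevel (p : ℕ) : Prop := p = 2 ∨ p = 3 ∨ p = 5 ∨ p = 7

namespace IsLevel

variable {p : ℕ}

lemma prime (hp : IsLevel p) : p.Prime := by
  rcases hp with rfl | rfl | rfl | rfl <;> norm_num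

lemma ne_zero (hp : IsLevel p) : p ≠ 0 := hp.prime.ne_zero

lemma weight_mul (hp : IsLevel p) : 24 / (p - 1) * (p - 1) = 24 := by
  rcases hp with rfl | rfl | rfl | rfl <;> norm_num

lemma weight_half (hp : IsLevel p) : 24 / (p - 1) = 2 * (12 / (p - 1)) := by
  rcases hp with rfl | rfl | rfl | rfl <;> norm_num

end IsLevel

lemma qParam_mul_nat (h : ℝ) (n : ℕ) (z : ℂ) : qParam h (n * z) = qParam h z ^ n := by
  rw [qParam, qParam, ← Complex.exp_nat_mul]
  congr 1
  ring

lemma qParam_add (h : ℝ) (z w : ℂ) : qParam h (z + w) = qParam h z * qParam h w := by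
  rw [qParam, qParam, qParam, ← Complex.exp_add]
  congr 1
  ring

lemma norm_qParam_one_lt {z : ℂ} (hz : 0 < z.im) : ‖qParam 1 z‖ < 1 :=
  Function.Periodic.norm_qParam_lt_one one_pos hz

/-- The eta quotient `psi` as a function of a complex variable. -/
noncomputable def etaQuot (p : ℕ) (z : ℂ) : ℂ :=
  (ModularForm.eta z / ModularForm.eta (p * z)) ^ (24 / (p - 1))

/-- The function of the nome `q` that `q * etaQuot p` is. -/
noncomputable def etaQuotReg (p : ℕ) (q : ℂ) : ℂ :=
  (eulerProd q * (eulerProd (q ^ p))⁻¹) ^ (24 / (p - 1))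

lemma eta_eq (z : ℂ) : ModularForm.eta z = qParam 24 z * eulerProd (qParam 1 z) := rfl

lemma im_natCast_mul {p : ℕ} (hp : p ≠ 0) {z : ℂ} (hz : 0 < z.im) : 0 < ((p : ℂ) * z).im := by
  rw [← Complex.ofReal_natCast, Complex.im_ofReal_mul]
  have : (0 : ℝ) < p := by exact_mod_cast hp.bot_lt
  positivity

section

variable {p : ℕ} (hp : IsLevel p) {z : ℂ} (hz : 0 < z.im)
include hp

/-- The fractional powers of q combine to exponent (1 - p)/24 · 24/(p - 1) = -1, so Ψ has a simple
pole at the cusp. -/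
lemma etaQuot_eq (z : ℂ) : etaQuot p z = (qParam 1 z)⁻¹ * etaQuotReg p (qParam 1 z) := by
  have h1 : (qParam 24 z / qParam 24 (p * z)) ^ (24 / (p - 1)) = (qParam 1 z)⁻¹ := by
    simp only [qParam, ← Complex.exp_sub, ← Complex.exp_nat_mul, ← Complex.exp_neg]
    congr 1
    rcases hp with rfl | rfl | rfl | rfl <;> norm_num <;> ring
  rw [etaQuot, etaQuotReg, ← h1, ← mul_pow, eta_eq, eta_eq, qParam_mul_nat 1]
  congr 1
  rw [mul_div_mul_comm, div_eq_mul_inv (eulerProd _)]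

/-- The power series of `q * etaQuot p`. -/
noncomputable def etaQuotSeries (p : ℕ) (hp : p ≠ 0) : PowerSeries ℤ :=
  (PowerSeries.pentagonalSeries ℤ *
    PowerSeries.expand p hp (PowerSeries.invOfUnit (PowerSeries.pentagonalSeries ℤ) 1)) ^
      (24 / (p - 1))

omit hp in
lemma constantCoeff_pentagonalSeries :
    PowerSeries.constantCoeff (PowerSeries.pentagonalSeries ℤ) = 1 := by
  rw [← PowerSeries.coeff_zero_eq_constantCoeff_apply, hasJet_pentagonalSeries 0 (by norm_num)]
  rfl

omit hp in
lemma pentagonalSeries_mul_invOfUnit : PowerSeries.pentagonalSeries ℤ *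
    PowerSeries.invOfUnit (PowerSeries.pentagonalSeries ℤ) 1 = 1 :=
  PowerSeries.mul_invOfUnit _ _ constantCoeff_pentagonalSeries

lemma isSeries_etaQuotReg :
    IsSeries ((etaQuotSeries p hp.ne_zero).map (Int.castRingHom ℂ)) (etaQuotReg p) := by
  have h := (isSeries_eulerProd.inv pentagonalSeries_mul_invOfUnit differentiableOn_eulerProd
    fun _ => eulerProd_ne_zero).expand hp.ne_zero
  have := (isSeries_eulerProd.mul h).pow (24 / (p - 1))
  rw [etaQuotSeries, map_pow, map_mul, PowerSeries.map_expand]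
  exact this

lemma constantCoeff_etaQuotSeries :
    PowerSeries.constantCoeff (etaQuotSeries p hp.ne_zero) = 1 := by
  simp [etaQuotSeries, constantCoeff_pentagonalSeries, PowerSeries.constantCoeff_expand]

lemma etaQuotReg_ne_zero {q : ℂ} (hq : ‖q‖ < 1) : etaQuotReg p q ≠ 0 :=
  pow_ne_zero _ (mul_ne_zero (eulerProd_ne_zero hq) (inv_ne_zero (eulerProd_ne_zero (by
    rw [norm_pow]; exact pow_lt_one₀ (norm_nonneg _) hq hp.ne_zero))))

lemma differentiableOn_etaQuotReg : DifferentiableOn ℂ (etaQuotReg p) (Metric.ball 0 1) := by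
  have hm : Set.MapsTo (fun q : ℂ => q ^ p) (Metric.ball 0 1) (Metric.ball 0 1) := fun q hq => by
    rw [mem_ball_zero_iff, norm_pow] at *
    exact pow_lt_one₀ (norm_nonneg _) hq hp.ne_zero
  refine (differentiableOn_eulerProd.mul (DifferentiableOn.inv (differentiableOn_eulerProd.comp
    (by fun_prop) hm) fun q hq => eulerProd_ne_zero (by simpa using hm hq))).pow _

include hz

lemma etaQuot_ne_zero : etaQuot p z ≠ 0 := by
  rw [etaQuot_eq hp]
  exact mul_ne_zero (inv_ne_zero (Complex.exp_ne_zero _))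
    (etaQuotReg_ne_zero hp (norm_qParam_one_lt hz))

omit hz in
lemma etaQuot_add_one (z : ℂ) : etaQuot p (z + 1) = etaQuot p z := by
  rw [etaQuot_eq hp, etaQuot_eq hp, qParam_add]
  simp [qParam]

omit hz in
lemma etaQuot_add_int (z : ℂ) (n : ℤ) : etaQuot p (z + n) = etaQuot p z := by
  have : Function.Periodic (etaQuot p) 1 := etaQuot_add_one hp
  simpa using this.int_mul n z

lemma differentiableAt_etaQuot : DifferentiableAt ℂ (etaQuot p) z := by
  have h : etaQuot p = fun z => (qParam 1 z)⁻¹ * etaQuotReg p (qParam 1 z) :=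
    funext (etaQuot_eq hp)
  have hd : DifferentiableAt ℂ (qParam 1) z := Function.Periodic.differentiable_qParam.differentiableAt
  rw [h]
  have hr : DifferentiableAt ℂ (etaQuotReg p) (qParam 1 z) :=
    (differentiableOn_etaQuotReg hp).differentiableAt
      (Metric.isOpen_ball.mem_nhds (mem_ball_zero_iff.mpr (norm_qParam_one_lt hz)))
  exact (hd.fun_inv (Complex.exp_ne_zero _)).mul (hr.comp z hd)

/-- The Fricke involution inverts the eta quotient. -/
lemma etaQuot_fricke : etaQuot p (-1 / (p * z)) * etaQuot p z = (p : ℂ) ^ (12 / (p - 1)) := by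
  have hpz := im_natCast_mul hp.ne_zero hz
  have h0 : z ≠ 0 := fun h => by simp [h] at hz
  have hp0 : (p : ℂ) ≠ 0 := by exact_mod_cast hp.ne_zero
  have h1 := ModularForm.eta_comp_eq_csqrt_I_inv hz
  have h2 := ModularForm.eta_comp_eq_csqrt_I_inv hpz
  simp only [Function.comp_apply, Pi.smul_apply, Pi.mul_apply, smul_eq_mul] at h1 h2
  have h3 : (p : ℂ) * (-1 / (p * z)) = -1 / z := by field_simp
  have hI : Complex.sqrt Complex.I ≠ 0 := by simp [Complex.sqrt]
  have hsz : Complex.sqrt z ≠ 0 := by simp [Complex.sqrt, h0]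
  have he1 := ModularForm.eta_ne_zero hz
  have he2 := ModularForm.eta_ne_zero hpz
  have hsq : Complex.sqrt (p * z) ^ 2 / Complex.sqrt z ^ 2 = p := by
    have : ∀ w : ℂ, Complex.sqrt w ^ 2 = w := fun w => by
      simp [Complex.sqrt]
    rw [this, this]
    field_simp
  -- The exponent 24/(p-1) is even, so only squares of the square roots in the inversion formula of
  -- η occur, and no branch has to be chosen.
  rw [etaQuot, etaQuot, h3, h1, h2, ← mul_pow, hp.weight_half, pow_mul]
  congr 1
  refine Eq.trans ?_ hsq
  generalize ModularForm.eta z = e1 at *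
  generalize ModularForm.eta (p * z) = e2 at *
  field_simp

end

/-! ### Numerical data of the conjugates -/

/-- The elementary symmetric functions of the `p + 1` conjugates of `etaQuot p`, with signs. -/
def conjCoeff (p : ℕ) : List ℤ :=
  if p = 2 then [1, 48] else if p = 3 then [1, 36, 270] else
  if p = 5 then [1, 30, 315, 1300, 1575] else [1, 28, 322, 1904, 5915, 8624, 4018]

/-- The power sums of the `p + 1` conjugates of `etaQuot p`. -/
def conjPowerSum (p : ℕ) : List ℤ :=
  if p = 2 then [0, -48] else if p = 3 then [0, -36, 756] else
  if p = 5 then [0, -30, 270, -2550, 24150] else [0, -28, 140, -616, 1820, 3332, -117208]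

/-- In degrees below p a series in q^p contributes only its constant term. -/
lemma coeff_mul_expand {p k : ℕ} (hp : p ≠ 0) (hk : k < p) (a b : PowerSeries ℤ)
    (hb : PowerSeries.constantCoeff b = 1) :
    coeff k (a * PowerSeries.expand p hp b) = coeff k a := by
  rw [PowerSeries.coeff_mul, Finset.sum_eq_single (k, 0)]
  · simp [PowerSeries.constantCoeff_expand, hb]
  · rintro ⟨i, j⟩ hij hne
    rw [Finset.HasAntidiagonal.mem_antidiagonal] at hij
    rw [PowerSeries.coeff_expand_of_not_dvd, mul_zero]
    intro hd
    have hj : j ≠ 0 := by rintro rfl; exact hne (by simp_all)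
    have := Nat.le_of_dvd (by omega) hd
    simp only at hij
    omega
  · simp

/-- Certifies the table `conjPowerSum`: the left side is the constant term of p · U_p(Ψ^k). Below
degree p the denominator η(pτ) plays no role, so the seven known coefficients of powers of Euler's
product suffice. -/
lemma coeff_etaQuotSeries_pow {p : ℕ} (hp : IsLevel p) {k : ℕ} (hk : k ≠ 0) (hkp : k < p) :
    (p : ℤ) * coeff k (etaQuotSeries p hp.ne_zero ^ k) = (conjPowerSum p).getD k 0 := by
  rw [etaQuotSeries, ← pow_mul, mul_pow, ← map_pow, coeff_mul_expand _ hkp _ _ (by simp)]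
  rcases hp with rfl | rfl | rfl | rfl <;> interval_cases k <;>
    first | exact absurd rfl hk | skip
  · rw [hasJet_pentagonalSeries_pow_24 1 (by norm_num)]; rfl
  · rw [hasJet_pentagonalSeries_pow_12 1 (by norm_num)]; rfl
  · rw [hasJet_pentagonalSeries_pow_24 2 (by norm_num)]; rfl
  · rw [hasJet_pentagonalSeries_pow_6 1 (by norm_num)]; rfl
  · rw [hasJet_pentagonalSeries_pow_12 2 (by norm_num)]; rfl
  · rw [hasJet_pentagonalSeries_pow_18 3 (by norm_num)]; rfl
  · rw [hasJet_pentagonalSeries_pow_24 4 (by norm_num)]; rfl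
  · rw [hasJet_pentagonalSeries_pow_4 1 (by norm_num)]; rfl
  · rw [hasJet_pentagonalSeries_pow_8 2 (by norm_num)]; rfl
  · rw [hasJet_pentagonalSeries_pow_12 3 (by norm_num)]; rfl
  · rw [hasJet_pentagonalSeries_pow_16 4 (by norm_num)]; rfl
  · rw [hasJet_pentagonalSeries_pow_20 5 (by norm_num)]; rfl
  · rw [hasJet_pentagonalSeries_pow_24 6 (by norm_num)]; rfl

/-! ### Invariance of the eta quotient under the matrices that are needed -/

lemma exists_specialLinearGroup {a b c d : ℤ} (h : a * d - b * c = 1) :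
    ∃ γ : Matrix.SpecialLinearGroup (Fin 2) ℤ, γ 0 0 = a ∧ γ 0 1 = b ∧ γ 1 0 = c ∧ γ 1 1 = d :=
  ⟨⟨!![a, b; c, d], by simpa [Matrix.det_fin_two] using h⟩, rfl, rfl, rfl, rfl⟩

lemma im_moebius_pos {a b c d : ℤ} (h : a * d - b * c = 1) {z : ℂ} (hz : 0 < z.im) :
    0 < ((a * z + b) / (c * z + d)).im := by
  obtain ⟨γ, rfl, rfl, rfl, rfl⟩ := exists_specialLinearGroup h
  have h1 := (γ • (⟨z, hz⟩ : ℍ)).im_pos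
  rw [← UpperHalfPlane.coe_im, UpperHalfPlane.coe_specialLinearGroup_apply] at h1
  simpa using h1

/-- η^24 is the discriminant, a form of weight 12 and level one. -/
lemma eta_pow_moebius {a b c d : ℤ} (h : a * d - b * c = 1) {z : ℂ} (hz : 0 < z.im) :
    ModularForm.eta ((a * z + b) / (c * z + d)) ^ 24 =
      (c * z + d) ^ 12 * ModularForm.eta z ^ 24 := by
  obtain ⟨γ, rfl, rfl, rfl, rfl⟩ := exists_specialLinearGroup h
  have h1 := congrFun (SlashInvariantForm.slash_action_generators_SL2Z
    ModularForm.discriminant_S_invariant ModularForm.discriminant_T_invariant γ) ⟨z, hz⟩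
  rw [ModularForm.SL_slash_apply] at h1
  have hden : UpperHalfPlane.denom γ (⟨z, hz⟩ : ℍ) = γ 1 0 * z + γ 1 1 :=
    ModularGroup.denom_apply γ ⟨z, hz⟩
  have hne := UpperHalfPlane.denom_ne_zero (γ : GL (Fin 2) ℝ) (⟨z, hz⟩ : ℍ)
  rw [hden] at h1 hne
  simp only [ModularForm.discriminant] at h1
  rw [UpperHalfPlane.coe_specialLinearGroup_apply] at h1
  simp only [algebraMap_int_eq, eq_intCast, Complex.ofReal_intCast] at h1
  generalize ((γ 1 0 : ℤ) : ℂ) * z + ((γ 1 1 : ℤ) : ℂ) = D at *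
  have hD : D ^ 12 * D ^ (-12 : ℤ) = 1 := by
    rw [← zpow_natCast, ← zpow_add₀ hne]
    norm_num
  linear_combination (D ^ 12) * h1 - ModularForm.eta (((γ 0 0 : ℤ) * z + (γ 0 1 : ℤ)) / D) ^ 24 * hD

lemma mul_sub_intCast_ne_zero {p : ℕ} (hp : p ≠ 0) {w : ℂ} (hw : 0 < w.im) (j : ℤ) :
    (p : ℂ) * w - j ≠ 0 := fun h0 => by
  have h1 := im_natCast_mul hp hw
  have := congrArg Complex.im h0
  simp only [Complex.sub_im, Complex.intCast_im, Complex.zero_im] at this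
  linarith

section

variable {p : ℕ} (hp : IsLevel p)
include hp

lemma etaQuot_pow (z : ℂ) :
    etaQuot p z ^ (p - 1) = ModularForm.eta z ^ 24 / ModularForm.eta (p * z) ^ 24 := by
  rw [etaQuot, ← pow_mul, hp.weight_mul, div_pow]

/-- Ψ^{p-1} is a quotient of two discriminants whose automorphy factors cancel. For Ψ itself this
leaves a root of unity to be determined. -/
lemma etaQuot_pow_moebius {j j' N : ℤ} (h : j * j' + 1 = p * N) {w : ℂ} (hw : 0 < w.im) :
    etaQuot p ((j * w - N) / (p * w - j')) ^ (p - 1) = etaQuot p w ^ (p - 1) := by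
  have hpw := im_natCast_mul hp.ne_zero hw
  have h1 := eta_pow_moebius (a := j) (b := -N) (c := p) (d := -j') (by linarith) hw
  have h2 := eta_pow_moebius (a := j) (b := -(p * N)) (c := 1) (d := -j') (by linarith) hpw
  push_cast at h1 h2
  rw [← sub_eq_add_neg, ← sub_eq_add_neg] at h1 h2
  have h3 : (p : ℂ) * ((j * w - N) / (p * w - j')) =
      (j * (p * w) - p * N) / (1 * (p * w) - j') := by ring
  have hne : (p : ℂ) * w - j' ≠ 0 := mul_sub_intCast_ne_zero hp.ne_zero hw j'
  have he := ModularForm.eta_ne_zero hpw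
  rw [etaQuot_pow hp, etaQuot_pow hp, h3, h1, h2, one_mul]
  field_simp

/-- The ratio of the two sides is continuous on the connected half-plane with values in the finite
set of (p-1)-th roots of unity, hence constant. The matrix has trace j - j' of absolute value below
2, so it fixes a point of the half-plane, where the ratio is 1. -/
lemma etaQuot_moebius_of_elliptic {j j' N : ℤ} (h : j * j' + 1 = p * N)
    (hell : (j - j') ^ 2 < 4) {w : ℂ} (hw : 0 < w.im) :
    etaQuot p ((j * w - N) / (p * w - j')) = etaQuot p w := by
  have him : ∀ w ∈ UpperHalfPlane.upperHalfPlaneSet, 0 < (((j : ℂ) * w - N) / (p * w - j')).im := fun w hw => by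
    have := im_moebius_pos (a := j) (b := -N) (c := p) (d := -j') (by linarith) hw
    simpa [← sub_eq_add_neg] using this
  have hp0 : (0 : ℝ) < p := by exact_mod_cast hp.ne_zero.bot_lt
  set f : ℂ → ℂ := fun w => etaQuot p ((j * w - N) / (p * w - j')) / etaQuot p w with hf
  have hcont : ContinuousOn f UpperHalfPlane.upperHalfPlaneSet := by
    intro w hw
    refine ContinuousAt.continuousWithinAt ?_
    have hne : (p : ℂ) * w - j' ≠ 0 := mul_sub_intCast_ne_zero hp.ne_zero hw j'
    refine ContinuousAt.div ?_ (differentiableAt_etaQuot hp hw).continuousAt (etaQuot_ne_zero hp hw)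
    refine ContinuousAt.comp (g := etaQuot p)
      (differentiableAt_etaQuot hp (him w hw)).continuousAt ?_
    exact ContinuousAt.div (by fun_prop) (by fun_prop) hne
  have hroot : Set.MapsTo f UpperHalfPlane.upperHalfPlaneSet {x : ℂ | x ^ (p - 1) = 1} := fun w hw => by
    rw [Set.mem_ofPred_eq, hf, div_pow, etaQuot_pow_moebius hp h hw]
    exact div_self (pow_ne_zero _ (etaQuot_ne_zero hp hw))
  have hfin : Set.Finite {x : ℂ | x ^ (p - 1) = 1} := by
    have hp1 : 0 < p - 1 := Nat.sub_pos_of_lt hp.prime.one_lt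
    refine (Polynomial.nthRoots (p - 1) (1 : ℂ)).toFinset.finite_toSet.subset fun x hx => ?_
    simpa [Polynomial.mem_nthRoots hp1] using hx
  have hconn : IsPreconnected UpperHalfPlane.upperHalfPlaneSet := (convex_halfSpace_im_gt 0).isPreconnected
  set s : ℝ := Real.sqrt (4 - ((j - j' : ℤ) : ℝ) ^ 2)
  have hell' : (0 : ℝ) < 4 - ((j - j' : ℤ) : ℝ) ^ 2 := by
    have : (((j - j') ^ 2 : ℤ) : ℝ) < (4 : ℤ) := by exact_mod_cast hell
    push_cast at this ⊢
    linarith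
  have hs : (s : ℂ) ^ 2 = 4 - ((j : ℂ) - j') ^ 2 := by
    rw [← Complex.ofReal_pow, Real.sq_sqrt hell'.le]
    push_cast
    ring
  -- The fixed point: the root in the upper half-plane of p w² - (j + j') w + N, whose discriminant
  -- is (j - j')² - 4.
  set w₀ : ℂ := ((j + j' : ℝ) + s * Complex.I) / (2 * p : ℝ) with hw₀
  have hw₀im : w₀ ∈ UpperHalfPlane.upperHalfPlaneSet := by
    show 0 < w₀.im
    rw [hw₀, Complex.div_ofReal_im]
    simp
    have := Real.sqrt_pos.mpr hell'
    positivity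
  have hfix : ((j : ℂ) * w₀ - N) / (p * w₀ - j') = w₀ := by
    have hne : (p : ℂ) * w₀ - j' ≠ 0 := mul_sub_intCast_ne_zero hp.ne_zero hw₀im j'
    have hpc : (p : ℂ) ≠ 0 := by exact_mod_cast hp.ne_zero
    have hN : (N : ℂ) = (j * j' + 1) / p := by
      field_simp
      exact_mod_cast (by linarith : N * p = j * j' + 1)
    rw [div_eq_iff hne, hN, hw₀]
    push_cast
    field_simp
    linear_combination hs - (s : ℂ) ^ 2 * Complex.I_sq
  have hconst := hconn.constant_of_mapsTo hfin.isDiscrete hcont hroot hw hw₀im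
  have h1 : f w₀ = 1 := by
    simp only [hf, hfix]
    exact div_self (etaQuot_ne_zero hp hw₀im)
  rw [h1] at hconst
  exact (div_eq_one_iff_eq (etaQuot_ne_zero hp hw)).mp hconst

omit hp in
lemma im_add_intCast_div {p : ℕ} (hp : p ≠ 0) {z : ℂ} (hz : 0 < z.im) (j : ℤ) :
    0 < ((z + j) / p).im := by
  have : (0 : ℝ) < p := by exact_mod_cast hp.bot_lt
  rw [← Complex.ofReal_natCast, Complex.div_ofReal_im]
  simp only [Complex.add_im, Complex.intCast_im, add_zero]
  positivity

omit hp in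
lemma im_neg_one_div {z : ℂ} (hz : 0 < z.im) : 0 < (-1 / z).im := by
  simpa using im_moebius_pos (a := 0) (b := -1) (c := 1) (d := 0) (by norm_num) hz

omit hp in
lemma ne_zero_of_im_pos {z : ℂ} (hz : 0 < z.im) : z ≠ 0 := fun h => by simp [h] at hz

lemma etaQuot_inversion_of_elliptic {j j' N : ℤ} (h : j * j' + 1 = p * N)
    (hell : (j - j') ^ 2 < 4) {z : ℂ} (hz : 0 < z.im) :
    etaQuot p ((-1 / z + j) / p) = etaQuot p ((z + j') / p) := by
  rw [← etaQuot_moebius_of_elliptic hp h hell (im_add_intCast_div hp.ne_zero hz j')]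
  congr 1
  have hz0 := ne_zero_of_im_pos hz
  have hpc : (p : ℂ) ≠ 0 := by exact_mod_cast hp.ne_zero
  have hN : (N : ℂ) = (j * j' + 1) / p := by
    field_simp
    exact_mod_cast (by linarith : N * p = j * j' + 1)
  have hden : (p : ℂ) * ((z + j') / p) - j' = z := by field_simp; ring
  rw [hden, hN]
  field_simp
  ring

/-- Here the matrix is parabolic and has no fixed point in the half-plane. The Fricke involution
conjugates it to an integer translation, under which Ψ is invariant. -/
lemma etaQuot_inversion_of_parabolic {ε : ℤ} (hε : ε ^ 2 = 1) {z : ℂ} (hz : 0 < z.im) :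
    etaQuot p ((-1 / z + ε) / p) = etaQuot p ((z + (-ε : ℤ)) / p) := by
  have hw := im_add_intCast_div hp.ne_zero hz (-ε)
  have hw' := im_add_intCast_div hp.ne_zero (im_neg_one_div hz) ε
  have hz0 := ne_zero_of_im_pos hz
  have hpc : (p : ℂ) ≠ 0 := by exact_mod_cast hp.ne_zero
  have hε' : (ε : ℂ) ^ 2 = 1 := by exact_mod_cast hε
  have h1 := etaQuot_fricke hp hw
  have h2 := etaQuot_fricke hp hw'
  have hK : (p : ℂ) ^ (12 / (p - 1)) ≠ 0 := pow_ne_zero _ hpc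
  have hne1 : z + (-ε : ℤ) ≠ 0 := fun h => by rw [h] at hw; simp at hw
  have hne2 : -1 / z + ε ≠ 0 := fun h => by rw [h] at hw'; simp at hw'
  have key : -1 / (p * ((-1 / z + ε) / p)) = -1 / (p * ((z + (-ε : ℤ)) / p)) + (-ε : ℤ) := by
    rw [mul_div_cancel₀ _ hpc, mul_div_cancel₀ _ hpc]
    have : -1 / z + ε = (ε * z - 1) / z := by field_simp; ring
    have hne3 : (ε : ℂ) * z - 1 ≠ 0 := fun h0 => hne2 (by rw [this, h0, zero_div])
    rw [this]
    push_cast at hne1 ⊢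
    field_simp
    linear_combination (z ^ 2 - ε * z + 1) * hε'
  rw [key, etaQuot_add_int hp, ← h1] at h2
  refine mul_left_cancel₀ (fun h0 => hK ?_) h2
  rw [← h1, h0, zero_mul]

lemma etaQuot_add_int_div_congr {j k : ℤ} (h : (p : ℤ) ∣ j - k) (z : ℂ) :
    etaQuot p ((z + j) / p) = etaQuot p ((z + k) / p) := by
  obtain ⟨c, hc⟩ := h
  have hpc : (p : ℂ) ≠ 0 := by exact_mod_cast hp.ne_zero
  rw [← etaQuot_add_int hp ((z + k) / p) c]
  congr 1
  have : (j : ℂ) = k + p * c := by exact_mod_cast (by linarith : j = k + p * c)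
  rw [this]
  field_simp
  ring

/-- Only residues modulo p matter. The classes ±1 are the parabolic case; the others, ±2 modulo 5
and ±2, ±3 modulo 7, have representatives with |j - j'| ≤ 1, hence elliptic: 2·2 + 1 = 5 and 2·3 + 1
= 7. -/
lemma etaQuot_inversion {j j' : ℤ} (h : (p : ℤ) ∣ j * j' + 1) {z : ℂ} (hz : 0 < z.im) :
    etaQuot p ((-1 / z + j) / p) = etaQuot p ((z + j') / p) := by
  suffices H : ∃ k k' : ℤ, (p : ℤ) ∣ j - k ∧ (p : ℤ) ∣ j' - k' ∧
      etaQuot p ((-1 / z + k) / p) = etaQuot p ((z + k') / p) by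
    obtain ⟨k, k', hk, hk', H⟩ := H
    rw [etaQuot_add_int_div_congr hp hk, etaQuot_add_int_div_congr hp hk', H]
  have hell : ∀ k k' : ℤ, (p : ℤ) ∣ k * k' + 1 → (k - k') ^ 2 < 4 →
      etaQuot p ((-1 / z + k) / p) = etaQuot p ((z + k') / p) := fun k k' hkk' hlt => by
    obtain ⟨N, hN⟩ := hkk'
    exact etaQuot_inversion_of_elliptic hp hN hlt hz
  have hpar1 := etaQuot_inversion_of_parabolic hp (ε := 1) (by norm_num) hz
  have hpar2 := etaQuot_inversion_of_parabolic hp (ε := -1) (by norm_num) hz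
  rw [neg_neg] at hpar2
  have key : ∀ k k' : ℤ, (p : ℤ) ∣ j - k → (p : ℤ) ∣ k * k' + 1 → (p : ℤ) ∣ j' - k' := by
    intro k k' hk hkk'
    have hpr := Nat.prime_iff_prime_int.mp hp.prime
    have h1 : (p : ℤ) ∣ k * (j' - k') := by
      rw [(by ring : k * (j' - k') = (j * j' + 1 - (k * k' + 1)) - (j - k) * j')]
      exact (h.sub hkk').sub (hk.mul_right j')
    refine (hpr.dvd_or_dvd h1).resolve_left fun hd => ?_
    exact hpr.not_isUnit (isUnit_of_dvd_one (by simpa using (hkk'.sub (hd.mul_right k'))))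
  have fin : ∀ k k' : ℤ, (p : ℤ) ∣ j - k → (p : ℤ) ∣ k * k' + 1 →
      etaQuot p ((-1 / z + k) / p) = etaQuot p ((z + k') / p) →
      ∃ k k' : ℤ, (p : ℤ) ∣ j - k ∧ (p : ℤ) ∣ j' - k' ∧
        etaQuot p ((-1 / z + k) / p) = etaQuot p ((z + k') / p) :=
    fun k k' h1 h2 h3 => ⟨k, k', h1, key k k' h1 h2, h3⟩
  have hj : ¬ (p : ℤ) ∣ j := fun hd => by
    have hpr := Nat.prime_iff_prime_int.mp hp.prime
    exact hpr.not_isUnit (isUnit_of_dvd_one (by simpa using (h.sub (hd.mul_right j'))))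
  rcases hp with rfl | rfl | rfl | rfl
  · exact fin 1 (-1) (by omega) (by norm_num) hpar1
  · rcases (by omega : ((3 : ℕ) : ℤ) ∣ j - 1 ∨ ((3 : ℕ) : ℤ) ∣ j - -1) with h1 | h1
    · exact fin 1 (-1) h1 (by norm_num) hpar1
    · exact fin (-1) 1 h1 (by norm_num) hpar2
  · rcases (by omega : ((5 : ℕ) : ℤ) ∣ j - 1 ∨ ((5 : ℕ) : ℤ) ∣ j - -1 ∨ ((5 : ℕ) : ℤ) ∣ j - 2 ∨ ((5 : ℕ) : ℤ) ∣ j - -2)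
      with h1 | h1 | h1 | h1
    · exact fin 1 (-1) h1 (by norm_num) hpar1
    · exact fin (-1) 1 h1 (by norm_num) hpar2
    · exact fin 2 2 h1 (by norm_num) (hell _ _ (by norm_num) (by norm_num))
    · exact fin (-2) (-2) h1 (by norm_num) (hell _ _ (by norm_num) (by norm_num))
  · rcases (by omega : ((7 : ℕ) : ℤ) ∣ j - 1 ∨ ((7 : ℕ) : ℤ) ∣ j - -1 ∨ ((7 : ℕ) : ℤ) ∣ j - 2 ∨ ((7 : ℕ) : ℤ) ∣ j - -2 ∨
        ((7 : ℕ) : ℤ) ∣ j - 3 ∨ ((7 : ℕ) : ℤ) ∣ j - -3) with h1 | h1 | h1 | h1 | h1 | h1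
    · exact fin 1 (-1) h1 (by norm_num) hpar1
    · exact fin (-1) 1 h1 (by norm_num) hpar2
    · exact fin 2 3 h1 (by norm_num) (hell _ _ (by norm_num) (by norm_num))
    · exact fin (-2) (-3) h1 (by norm_num) (hell _ _ (by norm_num) (by norm_num))
    · exact fin 3 2 h1 (by norm_num) (hell _ _ (by norm_num) (by norm_num))
    · exact fin (-3) (-2) h1 (by norm_num) (hell _ _ (by norm_num) (by norm_num))

end

/-! ### Expansions at the cusp and the operator U_p -/

lemma exists_qParam_eq {q : ℂ} (h0 : q ≠ 0) (hq : ‖q‖ < 1) :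
    ∃ z : ℂ, 0 < z.im ∧ qParam 1 z = q :=
  ⟨_, Function.Periodic.im_invQParam_pos_of_norm_lt_one one_pos hq h0,
    Function.Periodic.qParam_right_inv one_ne_zero h0⟩

lemma tendsto_atImInfty_of_hasSum {c : ℕ → ℂ} {F : ℂ → ℂ}
    (h : ∀ z : ℂ, 0 < z.im → HasSum (fun n : ℕ => c n * qParam 1 z ^ n) (F z)) :
    Tendsto (fun τ : ℍ => F τ) UpperHalfPlane.atImInfty (𝓝 (c 0)) := by
  have h1 := tendsto_of_hasSum (c := c) (F := fun q => ∑' n, c n * q ^ n) fun q h0 hq => by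
    obtain ⟨z, hz, rfl⟩ := exists_qParam_eq h0 hq
    exact (h z hz).summable.hasSum
  have h2 : Tendsto (fun τ : ℍ => qParam 1 τ) UpperHalfPlane.atImInfty (𝓝[≠] 0) :=
    tendsto_nhdsWithin_iff.mpr ⟨UpperHalfPlane.qParam_tendsto_atImInfty one_pos,
      .of_forall fun τ => Function.Periodic.qParam_ne_zero _⟩
  refine (h1.comp h2).congr fun τ => (h τ τ.im_pos).tsum_eq

lemma coeff_unique_of_hasSum {c d : ℕ → ℂ} {F : ℂ → ℂ}
    (h : ∀ z : ℂ, 0 < z.im → HasSum (fun n : ℕ => c n * qParam 1 z ^ n) (F z))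
    (h' : ∀ z : ℂ, 0 < z.im → HasSum (fun n : ℕ => d n * qParam 1 z ^ n) (F z)) : c = d := by
  refine sub_eq_zero.mp (eq_zero_of_hasSum_punctured fun q h0 hq => ?_)
  obtain ⟨z, hz, rfl⟩ := exists_qParam_eq h0 hq
  simpa [sub_mul] using (h z hz).sub (h' z hz)

/-- `F` is given on the upper half-plane by the Laurent expansion with coefficients `b`. -/
def LaurentExp (b : ℤ → ℂ) (F : ℂ → ℂ) : Prop :=
  ∀ z : ℂ, 0 < z.im → HasSum (fun n : ℤ => b n * qParam 1 z ^ n) (F z)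

/-- The coefficients of `q ^ (-m) * ∑ c n * q ^ n`. -/
def shiftCoeff {R : Type*} [Zero R] (m : ℕ) (c : ℕ → R) (n : ℤ) : R :=
  if -(m : ℤ) ≤ n then c (n + m).toNat else 0

lemma shiftCoeff_sub {R : Type*} [Zero R] (m : ℕ) (c : ℕ → R) (n : ℕ) :
    shiftCoeff m c (n - m) = c n := by
  simp [shiftCoeff]

lemma laurentExp_shiftCoeff {c : ℕ → ℂ} {m : ℕ} {F : ℂ → ℂ} (h : ∀ z : ℂ, 0 < z.im →
    HasSum (fun n : ℕ => c n * qParam 1 z ^ n) (qParam 1 z ^ m * F z)) :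
    LaurentExp (shiftCoeff m c) F := by
  intro z hz
  have hq : qParam 1 z ≠ 0 := Function.Periodic.qParam_ne_zero z
  have hinj : Function.Injective (fun n : ℕ => (n : ℤ) - m) := fun a b hab => by simpa using hab
  rw [← hinj.hasSum_iff]
  · have := (h z hz).mul_left (qParam 1 z ^ (-(m : ℤ)))
    rw [← mul_assoc, zpow_neg, zpow_natCast, inv_mul_cancel₀ (pow_ne_zero _ hq), one_mul] at this
    refine (congrArg (HasSum · (F z)) (funext fun n => ?_)).mp this
    rw [Function.comp_apply, shiftCoeff_sub, sub_eq_add_neg, zpow_add₀ hq, zpow_neg, zpow_natCast,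
      zpow_natCast]
    ring
  · intro n hn
    rw [shiftCoeff, if_neg, zero_mul]
    intro hle
    exact hn ⟨(n + m).toNat, by simp only; omega⟩

lemma LaurentExp.hasSum_nat {b : ℤ → ℂ} {F : ℂ → ℂ} (h : LaurentExp b F)
    (hb : ∀ n < 0, b n = 0) {z : ℂ} (hz : 0 < z.im) :
    HasSum (fun n : ℕ => b n * qParam 1 z ^ n) (F z) := by
  have := (Nat.cast_injective (R := ℤ)).hasSum_iff (f := fun n : ℤ => b n * qParam 1 z ^ n)
    (a := F z) fun n hn => by
      rw [hb n (lt_of_not_ge fun h0 => hn ⟨n.toNat, by omega⟩), zero_mul]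
  simpa [Function.comp_def] using this.mpr (h z hz)

/-- The operator `U_p` on functions on the upper half-plane. -/
noncomputable def heckeU (p : ℕ) (F : ℂ → ℂ) (z : ℂ) : ℂ :=
  (∑ j ∈ Finset.range p, F ((z + (j : ℤ)) / p)) / p

/-- Orthogonality of the p-th roots of unity; this is why averaging over the translates selects the
exponents divisible by p. -/
lemma sum_qParam_zpow {p : ℕ} (hp : p ≠ 0) (z : ℂ) (n : ℤ) :
    ∑ j ∈ Finset.range p, qParam 1 ((z + (j : ℤ)) / p) ^ n =
      if (p : ℤ) ∣ n then p * qParam 1 z ^ (n / p) else 0 := by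
  have hpc : (p : ℂ) ≠ 0 := by exact_mod_cast hp
  set ζ : ℂ := Complex.exp (2 * Real.pi * Complex.I / p)
  have hζ : IsPrimitiveRoot ζ p := Complex.isPrimitiveRoot_exp p hp
  have h1 : ∀ j : ℕ, qParam 1 ((z + (j : ℤ)) / p) ^ n = qParam p z ^ n * (ζ ^ n) ^ j := by
    intro j
    have : qParam 1 ((z + (j : ℤ)) / p) = qParam p z * ζ ^ j := by
      simp only [qParam, ζ, ← Complex.exp_nat_mul, ← Complex.exp_add]
      congr 1
      push_cast
      field_simp
    rw [this, mul_zpow, ← zpow_natCast, ← zpow_natCast, ← zpow_mul, ← zpow_mul, mul_comm n]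
  simp_rw [h1, ← Finset.mul_sum]
  split_ifs with hd
  · obtain ⟨m, rfl⟩ := hd
    have h2 : ζ ^ ((p : ℤ) * m) = 1 := by rw [zpow_mul, zpow_natCast, hζ.pow_eq_one, one_zpow]
    have h3 : qParam p z ^ ((p : ℤ)) = qParam 1 z := by
      rw [zpow_natCast, qParam, qParam, ← Complex.exp_nat_mul]
      congr 1
      push_cast
      field_simp
    rw [h2, zpow_mul, h3, Int.mul_ediv_cancel_left _ (by exact_mod_cast hp)]
    simp [mul_comm]
  · have hne : ζ ^ n ≠ 1 := fun h => hd ((hζ.zpow_eq_one_iff_dvd n).mp h)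
    have h2 : (ζ ^ n) ^ p = 1 := by
      rw [← zpow_natCast, ← zpow_mul, mul_comm, zpow_mul, zpow_natCast, hζ.pow_eq_one, one_zpow]
    have := mul_neg_geom_sum (ζ ^ n) p
    rw [h2, sub_self] at this
    rw [(mul_eq_zero.mp this).resolve_left (sub_ne_zero.mpr hne.symm), mul_zero]

lemma LaurentExp.heckeU {p : ℕ} (hp : p ≠ 0) {b : ℤ → ℂ} {F : ℂ → ℂ} (h : LaurentExp b F) :
    LaurentExp (fun n => b (p * n)) (heckeU p F) := by
  intro z hz
  have hpc : (p : ℂ) ≠ 0 := by exact_mod_cast hp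
  have hpz : (p : ℤ) ≠ 0 := by exact_mod_cast hp
  have h1 := (hasSum_sum (s := Finset.range p) fun (j : ℕ) _ =>
    h _ (im_add_intCast_div hp hz j)).div_const (p : ℂ)
  simp_rw [← Finset.mul_sum, sum_qParam_zpow hp] at h1
  rw [← (mul_right_injective₀ hpz).hasSum_iff] at h1
  · refine (congrArg (HasSum · (_root_.heckeU p F z)) (funext fun n => ?_)).mp h1
    simp only [Function.comp_apply, dvd_mul_right, if_true, Int.mul_ediv_cancel_left _ hpz]
    field_simp
  · intro n hn
    rw [if_neg, mul_zero, zero_div]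
    rintro ⟨m, rfl⟩
    exact hn ⟨m, rfl⟩

/-! ### Level one functions and the conjugates -/

open scoped ModularForm MatrixGroups in
/-- A holomorphic modular function of level one with a limit at the cusp is constant. -/
lemma eq_of_levelOne {F : ℂ → ℂ} {c : ℂ} (hd : ∀ z : ℂ, 0 < z.im → DifferentiableAt ℂ F z)
    (hT : ∀ z : ℂ, 0 < z.im → F (z + 1) = F z) (hS : ∀ z : ℂ, 0 < z.im → F (-1 / z) = F z)
    (hlim : Tendsto (fun τ : ℍ => F τ) UpperHalfPlane.atImInfty (𝓝 c)) {z : ℂ} (hz : 0 < z.im) :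
    F z = c := by
  have hT' : (fun τ : ℍ => F τ) ∣[(0 : ℤ)] ModularGroup.T = fun τ : ℍ => F τ := by
    ext τ
    rw [ModularForm.SL_slash_apply, UpperHalfPlane.modular_T_smul]
    simpa [add_comm] using hT τ τ.im_pos
  have hS' : (fun τ : ℍ => F τ) ∣[(0 : ℤ)] ModularGroup.S = fun τ : ℍ => F τ := by
    ext τ
    rw [ModularForm.SL_slash_apply, UpperHalfPlane.modular_S_smul]
    simpa [neg_div, inv_neg] using hS τ τ.im_pos
  have hall := SlashInvariantForm.slash_action_generators_SL2Z hS' hT'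
  let f : ModularForm 𝒮ℒ 0 :=
    { toFun := fun τ => F τ
      slash_action_eq' := fun A hA => by
        obtain ⟨A, rfl⟩ := hA
        exact hall A
      holo' := by
        rw [UpperHalfPlane.mdifferentiable_iff]
        refine DifferentiableOn.congr (f := F)
          (fun z hz => (hd z hz).differentiableWithinAt) fun z hz => ?_
        simp [UpperHalfPlane.ofComplex_apply_of_im_pos hz]
      bdd_at_cusps' := fun hc => by
        rw [Subgroup.IsArithmetic.isCusp_iff_isCusp_SL2Z] at hc
        rw [OnePoint.isBoundedAt_iff_forall_SL2Z hc]
        intro γ _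
        rw [hall γ]
        exact hlim.isBigO_one ℝ }
  obtain ⟨c', hc'⟩ := ModularFormClass.levelOne_weight_zero_const f
  have h1 : ∀ τ : ℍ, F τ = c' := fun τ => congrFun hc' τ
  have h2 : c = c' := tendsto_nhds_unique hlim (by simp_rw [h1]; exact tendsto_const_nhds)
  rw [h2]
  exact h1 ⟨z, hz⟩

/-- The conjugates of `etaQuot p` over the field of modular functions of level one. -/
noncomputable def conjugate (p : ℕ) (z : ℂ) : Option (ZMod p) → ℂ
  | none => (p : ℂ) ^ (12 / (p - 1)) / etaQuot p z
  | some j => etaQuot p ((z + (j.val : ℤ)) / p)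

/-- The action of `z ↦ -1 / z` on the indices of the conjugates. -/
def inversionIndex {p : ℕ} [Fact p.Prime] : Option (ZMod p) → Option (ZMod p)
  | none => some 0
  | some j => if j = 0 then none else some (-j⁻¹)

lemma inversionIndex_involutive {p : ℕ} [Fact p.Prime] :
    Function.Involutive (inversionIndex (p := p)) := by
  rintro (_ | j)
  · simp [inversionIndex]
  · by_cases hj : j = 0
    · simp [inversionIndex, hj]
    · simp [inversionIndex, hj]

section

variable {p : ℕ} (hp : IsLevel p) [Fact p.Prime] {z : ℂ} (hz : 0 < z.im)
include hp

lemma conjugate_add_one (z : ℂ) (i : Option (ZMod p)) :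
    conjugate p (z + 1) i = conjugate p z ((Equiv.optionCongr (Equiv.addRight (1 : ZMod p))) i) := by
  cases i with
  | none => simp [conjugate, etaQuot_add_one hp]
  | some j =>
    simp only [conjugate, Equiv.optionCongr_apply, Option.map_some, Equiv.coe_addRight]
    have h : (p : ℤ) ∣ (j.val + 1 : ℤ) - ((j + 1).val : ℤ) := by
      rw [← ZMod.intCast_zmod_eq_zero_iff_dvd]
      simp
    rw [← etaQuot_add_int_div_congr hp h]
    push_cast
    ring_nf

include hz

/-- The Fricke involution exchanges the indices `none` and 0; on the other indices the permutation
is j ↦ -1/j, by `etaQuot_inversion`. -/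
lemma conjugate_inversion (i : Option (ZMod p)) :
    conjugate p (-1 / z) i = conjugate p z (inversionIndex i) := by
  have hpc : (p : ℂ) ≠ 0 := by exact_mod_cast hp.ne_zero
  have hz0 := ne_zero_of_im_pos hz
  cases i with
  | none =>
    have hzp : 0 < (z / p).im := by simpa using im_add_intCast_div hp.ne_zero hz 0
    have h := etaQuot_fricke hp hzp
    rw [mul_div_cancel₀ _ hpc] at h
    have h0 := etaQuot_ne_zero hp (im_neg_one_div hz)
    simp only [conjugate, inversionIndex, ZMod.val_zero, Nat.cast_zero, Int.cast_zero, add_zero]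
    rw [div_eq_iff h0, mul_comm, h]
  | some j =>
    by_cases hj : j = 0
    · have h := etaQuot_fricke hp hz
      simp only [conjugate, inversionIndex, hj, if_true, ZMod.val_zero, Nat.cast_zero,
        Int.cast_zero, add_zero]
      rw [eq_div_iff (etaQuot_ne_zero hp hz), ← h, div_div, mul_comm z]
    · simp only [conjugate, inversionIndex, hj, if_false]
      refine etaQuot_inversion hp ?_ hz
      rw [← ZMod.intCast_zmod_eq_zero_iff_dvd]
      simp [hj]

omit [Fact p.Prime] in
lemma differentiableAt_conjugate (i : Option (ZMod p)) :
    DifferentiableAt ℂ (fun z => conjugate p z i) z := by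
  cases i with
  | none =>
    exact (differentiableAt_const _).div (differentiableAt_etaQuot hp hz) (etaQuot_ne_zero hp hz)
  | some j =>
    exact DifferentiableAt.comp (g := etaQuot p) z
      (differentiableAt_etaQuot hp (im_add_intCast_div hp.ne_zero hz _)) (by fun_prop)

omit hz in
lemma sum_conjugate_pow_eq_of_tendsto {k : ℕ} {c : ℂ}
    (hlim : Tendsto (fun τ : ℍ => ∑ i, conjugate p τ i ^ k) UpperHalfPlane.atImInfty (𝓝 c))
    {z : ℂ} (hz : 0 < z.im) : ∑ i, conjugate p z i ^ k = c := by
  refine eq_of_levelOne (F := fun z => ∑ i, conjugate p z i ^ k) (fun z hz => ?_) (fun z _ => ?_)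
    (fun z hz => ?_) hlim hz
  · exact DifferentiableAt.fun_sum fun i _ => (differentiableAt_conjugate hp hz i).fun_pow k
  · simp_rw [conjugate_add_one hp]
    exact Equiv.sum_comp _ fun i => conjugate p z i ^ k
  · simp_rw [conjugate_inversion hp hz]
    exact Equiv.sum_comp inversionIndex_involutive.toPerm fun i => conjugate p z i ^ k

omit hz in
lemma prod_conjugate_eq_of_tendsto {c : ℂ}
    (hlim : Tendsto (fun τ : ℍ => ∏ i, conjugate p τ i) UpperHalfPlane.atImInfty (𝓝 c))
    {z : ℂ} (hz : 0 < z.im) : ∏ i, conjugate p z i = c := by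
  refine eq_of_levelOne (F := fun z => ∏ i, conjugate p z i) (fun z hz => ?_) (fun z _ => ?_)
    (fun z hz => ?_) hlim hz
  · exact DifferentiableAt.fun_finsetProd fun i _ => differentiableAt_conjugate hp hz i
  · simp_rw [conjugate_add_one hp]
    exact Equiv.prod_comp _ fun i => conjugate p z i
  · simp_rw [conjugate_inversion hp hz]
    exact Equiv.prod_comp inversionIndex_involutive.toPerm fun i => conjugate p z i

end

/-! ### Power sums and product of the translates -/

lemma prod_zmod_val {M : Type*} [CommMonoid M] {p : ℕ} [NeZero p] (f : ℕ → M) :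
    ∏ j : ZMod p, f j.val = ∏ j ∈ Finset.range p, f j := by
  obtain ⟨n, rfl⟩ := Nat.exists_eq_succ_of_ne_zero (NeZero.ne p)
  exact (Finset.prod_range f).symm

lemma sum_zmod_val {M : Type*} [AddCommMonoid M] {p : ℕ} [NeZero p] (f : ℕ → M) :
    ∑ j : ZMod p, f j.val = ∑ j ∈ Finset.range p, f j := by
  obtain ⟨n, rfl⟩ := Nat.exists_eq_succ_of_ne_zero (NeZero.ne p)
  exact (Finset.sum_range f).symm

section

variable {p : ℕ} (hp : IsLevel p)
include hp

lemma laurentExp_etaQuot_pow (k : ℕ) : LaurentExp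
    (shiftCoeff k fun n => ((coeff n (etaQuotSeries p hp.ne_zero ^ k) : ℤ) : ℂ))
    (fun z => etaQuot p z ^ k) := by
  refine laurentExp_shiftCoeff fun z hz => ?_
  have h := (isSeries_etaQuotReg hp).pow k _ (norm_qParam_one_lt hz)
  rw [← map_pow] at h
  simp only [PowerSeries.coeff_map, eq_intCast] at h
  rwa [etaQuot_eq hp, ← mul_pow, mul_inv_cancel_left₀ (Function.Periodic.qParam_ne_zero z)]

lemma tendsto_etaQuotReg_comp {g : ℍ → ℂ} (hg : Tendsto g UpperHalfPlane.atImInfty (𝓝 0)) :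
    Tendsto (fun τ => etaQuotReg p (g τ)) UpperHalfPlane.atImInfty (𝓝 1) := by
  have h1 : ContinuousAt (etaQuotReg p) 0 := ((differentiableOn_etaQuotReg hp).differentiableAt
    (Metric.isOpen_ball.mem_nhds (by simp))).continuousAt
  have h2 : etaQuotReg p 0 = 1 := by
    have := (isSeries_etaQuotReg hp 0 (by simp)).unique (hasSum_single 0 fun n hn => by simp [hn])
    simpa [constantCoeff_etaQuotSeries hp] using this
  rw [← h2]
  exact h1.tendsto.comp hg

lemma tendsto_inv_etaQuot :
    Tendsto (fun τ : ℍ => (etaQuot p τ)⁻¹) UpperHalfPlane.atImInfty (𝓝 0) := by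
  have hq := UpperHalfPlane.qParam_tendsto_atImInfty one_pos
  have h := hq.mul ((tendsto_etaQuotReg_comp hp hq).inv₀ one_ne_zero)
  rw [zero_mul] at h
  refine h.congr fun τ => ?_
  rw [etaQuot_eq hp, mul_inv, inv_inv]

/-- The power sums of the translates of `etaQuot p`. -/
lemma sum_etaQuot_pow {k : ℕ} (hk : k ≠ 0) (hkp : k < p) {z : ℂ} (hz : 0 < z.im) :
    ∑ j ∈ Finset.range p, etaQuot p ((z + (j : ℤ)) / p) ^ k =
      ((conjPowerSum p).getD k 0 : ℤ) - ((p : ℂ) ^ (12 / (p - 1)) / etaQuot p z) ^ k := by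
  have : Fact p.Prime := ⟨hp.prime⟩
  have hpc : (p : ℂ) ≠ 0 := by exact_mod_cast hp.ne_zero
  have hsum : ∀ z, ∑ i, conjugate p z i ^ k = ((p : ℂ) ^ (12 / (p - 1)) / etaQuot p z) ^ k +
      ∑ j ∈ Finset.range p, etaQuot p ((z + (j : ℤ)) / p) ^ k := fun z => by
    rw [Fintype.sum_option, ← sum_zmod_val fun j => etaQuot p ((z + (j : ℤ)) / p) ^ k]
    rfl
  rw [eq_sub_iff_add_eq', ← hsum]
  refine sum_conjugate_pow_eq_of_tendsto hp ?_ hz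
  simp_rw [hsum]
  have h1 := ((laurentExp_etaQuot_pow hp k).heckeU hp.ne_zero)
  -- Since k < p, the pole of order k of Ψ^k contributes no negative exponent divisible by p, so
  -- U_p(Ψ^k) is bounded at the cusp.
  have h2 := tendsto_atImInfty_of_hasSum fun z hz => h1.hasSum_nat (fun n hn => by
    rw [shiftCoeff, if_neg]
    have : (p : ℤ) * n ≤ p * (-1) := by gcongr; omega
    omega) hz
  have h3 := h2.const_mul (p : ℂ)
  have h4 : (p : ℂ) * shiftCoeff k (fun n => ((coeff n (etaQuotSeries p hp.ne_zero ^ k) : ℤ) : ℂ))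
      (p * (0 : ℕ)) = ((conjPowerSum p).getD k 0 : ℤ) := by
    rw [← coeff_etaQuotSeries_pow hp hk hkp]
    simp [shiftCoeff]
  rw [h4] at h3
  have h5 := (((tendsto_inv_etaQuot hp).const_mul ((p : ℂ) ^ (12 / (p - 1)))).pow k).add h3
  rw [mul_zero, zero_pow hk, zero_add] at h5
  refine h5.congr fun τ => ?_
  rw [heckeU, mul_div_cancel₀ _ hpc, div_eq_mul_inv]

/-- The product of the translates of `etaQuot p`. -/
lemma prod_etaQuot {z : ℂ} (hz : 0 < z.im) :
    ∏ j ∈ Finset.range p, etaQuot p ((z + (j : ℤ)) / p) = (-1) ^ (p - 1) * etaQuot p z := by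
  have : Fact p.Prime := ⟨hp.prime⟩
  have hpc : (p : ℂ) ≠ 0 := by exact_mod_cast hp.ne_zero
  have hprod : ∀ z, ∏ i, conjugate p z i = (p : ℂ) ^ (12 / (p - 1)) / etaQuot p z *
      ∏ j ∈ Finset.range p, etaQuot p ((z + (j : ℤ)) / p) := fun z => by
    rw [Fintype.prod_option, ← prod_zmod_val fun j => etaQuot p ((z + (j : ℤ)) / p)]
    rfl
  -- The leading factors of the translates multiply to ±q^{-1}, which cancels the zero of 1/Ψ(z).
  -- The sign comes from 0 + 1 + ⋯ + (p-1) = p(p-1)/2.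
  have hq : ∀ z, ∏ j ∈ Finset.range p, qParam 1 ((z + (j : ℤ)) / p) =
      (-1) ^ (p - 1) * qParam 1 z := fun z => by
    simp only [qParam]
    rw [← Complex.exp_sum, ← Complex.exp_pi_mul_I, ← Complex.exp_nat_mul, ← Complex.exp_add]
    congr 1
    rw [← Finset.sum_div, ← Finset.mul_sum, ← Finset.sum_div, Finset.sum_add_distrib]
    have : ∑ j ∈ Finset.range p, (((j : ℕ) : ℤ) : ℂ) = p * (p - 1 : ℕ) / 2 := by
      have := Finset.sum_range_id_mul_two p
      rw [eq_div_iff two_ne_zero]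
      simp_rw [Int.cast_natCast]
      rw [← Nat.cast_sum]
      exact_mod_cast this
    rw [this]
    simp
    field_simp
    ring
  suffices H : ∏ i, conjugate p z i = (p : ℂ) ^ (12 / (p - 1)) * (-1) ^ (p - 1) by
    rw [hprod] at H
    have h0 := etaQuot_ne_zero hp hz
    have hK : (p : ℂ) ^ (12 / (p - 1)) ≠ 0 := pow_ne_zero _ hpc
    field_simp at H
    linear_combination H
  refine prod_conjugate_eq_of_tendsto hp ?_ hz
  have hlimj : ∀ j : ℕ, Tendsto (fun τ : ℍ => qParam 1 (((τ : ℂ) + (j : ℤ)) / p))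
      UpperHalfPlane.atImInfty (𝓝 0) := fun j => by
    rw [tendsto_zero_iff_norm_tendsto_zero]
    have := (UpperHalfPlane.qParam_tendsto_atImInfty
      (h := p) (by exact_mod_cast hp.ne_zero.bot_lt)).norm
    rw [norm_zero] at this
    refine this.congr fun τ => ?_
    rw [Function.Periodic.norm_qParam, Function.Periodic.norm_qParam, ← Complex.ofReal_natCast p,
      Complex.div_ofReal_im]
    simp
    ring
  have h1 := tendsto_finsetProd (Finset.range p) fun j _ => tendsto_etaQuotReg_comp hp (hlimj j)
  have h2 := (tendsto_etaQuotReg_comp hp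
    (UpperHalfPlane.qParam_tendsto_atImInfty one_pos)).inv₀ one_ne_zero
  have h3 := (h2.mul h1).const_mul ((p : ℂ) ^ (12 / (p - 1)) * (-1) ^ (p - 1))
  simp only [Finset.prod_const_one, inv_one, mul_one] at h3
  refine h3.congr fun τ => ?_
  rw [hprod]
  simp_rw [etaQuot_eq hp ((_ : ℂ) / p), Finset.prod_mul_distrib, Finset.prod_inv_distrib, hq,
    etaQuot_eq hp (τ : ℂ)]
  have hq0 := Function.Periodic.qParam_ne_zero (h := 1) (τ : ℂ)
  have hr := etaQuotReg_ne_zero hp (norm_qParam_one_lt τ.im_pos)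
  have hs : ((-1 : ℂ) ^ (p - 1)) * (-1) ^ (p - 1) = 1 := by
    rw [← mul_pow]; norm_num
  field_simp
  linear_combination (∏ j ∈ Finset.range p,
    etaQuotReg p (qParam 1 (((τ : ℂ) + (j : ℤ)) / p))) * hs

end

/-! ### Newton's identities and the modular equation -/

/-- The elementary symmetric functions with alternating signs. -/
noncomputable def signedEsymm {p : ℕ} (y : Fin p → ℂ) (n : ℕ) : ℂ :=
  (-1) ^ n * MvPolynomial.aeval y (MvPolynomial.esymm (Fin p) ℂ n)

lemma prod_sub_eq_sum_signedEsymm {p : ℕ} (y : Fin p → ℂ) (t : ℂ) :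
    ∏ i, (t - y i) = ∑ k ∈ Finset.range (p + 1), signedEsymm y k * t ^ (p - k) := by
  have h := Multiset.prod_X_sub_X_eq_sum_esymm (Finset.univ.val.map y)
  have h2 := congrArg (Polynomial.eval t) h
  rw [Multiset.map_map, Polynomial.eval_multiset_prod, Multiset.map_map,
    Polynomial.eval_finsetSum] at h2
  simp only [Multiset.card_map, Finset.card_val, Finset.card_univ, Fintype.card_fin] at h2
  have h3 : ∏ i, (t - y i) = (Multiset.map (Polynomial.eval t ∘ ((fun t =>
      Polynomial.X - Polynomial.C t) ∘ y)) Finset.univ.val).prod := by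
    rw [Finset.prod_eq_multiset_prod]
    simp [Function.comp_def]
  rw [h3, h2]
  refine Finset.sum_congr rfl fun k _ => ?_
  rw [signedEsymm, MvPolynomial.aeval_esymm_eq_multiset_esymm]
  simp [mul_assoc]

lemma signedEsymm_zero {p : ℕ} (y : Fin p → ℂ) : signedEsymm y 0 = 1 := by
  simp [signedEsymm]

lemma signedEsymm_self {p : ℕ} (y : Fin p → ℂ) : signedEsymm y p = (-1) ^ p * ∏ i, y i := by
  have h := prod_sub_eq_sum_signedEsymm y 0
  rw [Finset.sum_range_succ, Finset.sum_eq_zero] at h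
  · rw [Nat.sub_self, pow_zero, mul_one, zero_add] at h
    rw [← h]
    simp [Finset.prod_neg]
  · intro k hk
    rw [zero_pow (Nat.sub_ne_zero_of_lt (Finset.mem_range.mp hk)), mul_zero]

lemma sum_signedEsymm_mul_pow {p : ℕ} (y : Fin p → ℂ) (i : Fin p) :
    ∑ k ∈ Finset.range (p + 1), signedEsymm y k * y i ^ (p - k) = 0 := by
  rw [← prod_sub_eq_sum_signedEsymm]
  exact Finset.prod_eq_zero (Finset.mem_univ i) (sub_self _)

lemma newton_signedEsymm {p : ℕ} (y : Fin p → ℂ) (n : ℕ) :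
    n * signedEsymm y n + ∑ k ∈ Finset.range n, signedEsymm y k * ∑ i, y i ^ (n - k) = 0 := by
  have h := congrArg (MvPolynomial.aeval y) (MvPolynomial.mul_esymm_eq_sum (Fin p) ℂ n)
  have h2 : ∑ a ∈ Finset.HasAntidiagonal.antidiagonal n with a.1 < n,
      (-1 : ℂ) ^ a.1 * MvPolynomial.aeval y (MvPolynomial.esymm (Fin p) ℂ a.1) *
        MvPolynomial.aeval y (MvPolynomial.psum (Fin p) ℂ a.2) =
      ∑ k ∈ Finset.range n, signedEsymm y k * ∑ i, y i ^ (n - k) := by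
    rw [Finset.sum_filter, Finset.Nat.sum_antidiagonal_eq_sum_range_succ_mk, Finset.sum_range_succ,
      if_neg (lt_irrefl n), add_zero]
    refine Finset.sum_congr rfl fun k hk => ?_
    rw [if_pos (Finset.mem_range.mp hk), signedEsymm]
    simp [MvPolynomial.psum]
  simp only [map_mul, map_sum, map_pow, map_neg, map_one, map_natCast] at h
  rw [h2] at h
  rw [signedEsymm]
  have hs : ((-1 : ℂ) ^ n) * (-1) ^ (n + 1) = -1 := by
    rw [← pow_add, Odd.neg_one_pow ⟨n, by ring⟩]
  linear_combination (-1) ^ n * h +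
    (∑ k ∈ Finset.range n, signedEsymm y k * ∑ i, y i ^ (n - k)) * hs

/-- The signed elementary symmetric functions of the translates of `etaQuot p`. -/
noncomputable def translateCoeff (p : ℕ) (x : ℂ) (n : ℕ) : ℂ :=
  ∑ i ∈ Finset.range (n + 1), ((conjCoeff p).getD i 0 : ℤ) * x ^ (n - i)

/-- Modulo t^p, division of ∑ `conjCoeff` i · t^i by 1 - xt removes the conjugate x: the quotient
has coefficients `translateCoeff`, and the power sums drop by powers of x. For each p this is a
finite list of polynomial identities. -/
lemma newton_translateCoeff {p : ℕ} (hp : IsLevel p) {n : ℕ} (hn : n < p) (x : ℂ) :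
    n * translateCoeff p x n + ∑ k ∈ Finset.range n, translateCoeff p x k *
      (((conjPowerSum p).getD (n - k) 0 : ℤ) - x ^ (n - k)) = 0 := by
  rcases hp with rfl | rfl | rfl | rfl <;> interval_cases n <;>
    simp [translateCoeff, Finset.sum_range_succ, conjCoeff, conjPowerSum] <;> ring

section

variable {p : ℕ} (hp : IsLevel p) {z : ℂ} (hz : 0 < z.im)
include hp hz

/-- Both sides satisfy Newton's recursion with the same power sums, which determines them over ℂ. -/
lemma signedEsymm_translates {n : ℕ} (hn : n < p) :
    signedEsymm (fun j : Fin p => etaQuot p ((z + ((j : ℕ) : ℤ)) / p)) n =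
      translateCoeff p ((p : ℂ) ^ (12 / (p - 1)) / etaQuot p z) n := by
  induction n using Nat.strong_induction_on with
  | _ n ih =>
    rcases Nat.eq_zero_or_pos n with rfl | hn0
    · rw [signedEsymm_zero]
      rcases hp with rfl | rfl | rfl | rfl <;> simp [translateCoeff, conjCoeff]
    have h1 := newton_signedEsymm (fun j : Fin p => etaQuot p ((z + ((j : ℕ) : ℤ)) / p)) n
    have h2 := newton_translateCoeff hp hn ((p : ℂ) ^ (12 / (p - 1)) / etaQuot p z)
    have h3 : (n : ℂ) ≠ 0 := by exact_mod_cast hn0.ne'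
    refine mul_left_cancel₀ h3 ?_
    rw [eq_neg_of_add_eq_zero_left h1, eq_neg_of_add_eq_zero_left h2]
    congr 1
    refine Finset.sum_congr rfl fun k hk => ?_
    have hk := Finset.mem_range.mp hk
    rw [ih k hk (hk.trans hn), ← sum_etaQuot_pow hp (by omega) (by omega) hz]
    rw [Finset.sum_range fun j : ℕ => etaQuot p ((z + (j : ℤ)) / p) ^ (n - k)]

lemma signedEsymm_translates_self :
    signedEsymm (fun j : Fin p => etaQuot p ((z + ((j : ℕ) : ℤ)) / p)) p = -etaQuot p z := by
  have h := prod_etaQuot hp hz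
  rw [Finset.prod_range] at h
  rw [signedEsymm_self, h, ← mul_assoc, ← pow_add, Odd.neg_one_pow, neg_one_mul]
  have := hp.prime.pos
  exact ⟨p - 1, by omega⟩

/-- The modular equation satisfied by the translates of `etaQuot p`. -/
lemma translate_equation {j : ℕ} (hj : j < p) :
    ∑ k ∈ Finset.range p, translateCoeff p ((p : ℂ) ^ (12 / (p - 1)) / etaQuot p z) k *
      etaQuot p ((z + (j : ℤ)) / p) ^ (p - k) = etaQuot p z := by
  have h := sum_signedEsymm_mul_pow
    (fun j : Fin p => etaQuot p ((z + ((j : ℕ) : ℤ)) / p)) ⟨j, hj⟩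
  rw [Finset.sum_range_succ, signedEsymm_translates_self hp hz, Nat.sub_self, pow_zero, mul_one] at h
  rw [← sub_eq_zero, ← h, sub_eq_add_neg]
  congr 1
  exact Finset.sum_congr rfl fun k hk => by
    rw [signedEsymm_translates hp hz (Finset.mem_range.mp hk)]

end

/-! ### Integral lattices and the action of U_p on powers of Ψ -/

/-- The exponent of `p` by which `1 / etaQuot p` is scaled. -/
def scaleExp (p : ℕ) : ℕ := if p = 2 then 3 else 1

/-- The exponent of `p` dividing the regular part of `U_p` applied to `etaQuot p ^ n`. -/
def polarExp (p : ℕ) : ℕ := if p = 2 then 8 else if p = 3 then 4 else if p = 5 then 1 else 0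

/-- The exponent of `p` gained by an application of `U_p`. -/
def gainExp (p : ℕ) : ℕ := if p = 2 then 3 else if p = 3 then 2 else 1

/-- The reciprocal of `etaQuot p`, scaled by a power of `p`. -/
noncomputable def scaledInv (p : ℕ) (z : ℂ) : ℂ := (p : ℂ) ^ scaleExp p / etaQuot p z

/-- `f` is `p ^ e` times an integral polynomial in `scaledInv p` without constant term. -/
def IsRegularMultiple (p e : ℕ) (f : ℂ → ℂ) : Prop :=
  ∃ H : ℤ[X], H.coeff 0 = 0 ∧
    ∀ z : ℂ, 0 < z.im → f z = (p : ℂ) ^ e * Polynomial.aeval (scaledInv p z) H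

/-- `f` is the sum of an integral polynomial in `etaQuot p` and `p ^ polarExp p` times an integral
polynomial in `scaledInv p` without constant term. -/
def IsMixed (p : ℕ) (f : ℂ → ℂ) : Prop :=
  ∃ R H : ℤ[X], H.coeff 0 = 0 ∧ ∀ z : ℂ, 0 < z.im →
    f z = Polynomial.aeval (etaQuot p z) R + (p : ℂ) ^ polarExp p * Polynomial.aeval (scaledInv p z) H

namespace IsRegularMultiple

variable {p e e' : ℕ} {f g : ℂ → ℂ}

lemma congr (hf : IsRegularMultiple p e f) (h : ∀ z : ℂ, 0 < z.im → g z = f z) :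
    IsRegularMultiple p e g := by
  obtain ⟨H, h0, hH⟩ := hf
  exact ⟨H, h0, fun z hz => (h z hz).trans (hH z hz)⟩

lemma zero : IsRegularMultiple p e (fun _ => 0) := ⟨0, by simp, by simp⟩

lemma add (hf : IsRegularMultiple p e f) (hg : IsRegularMultiple p e g) :
    IsRegularMultiple p e (fun z => f z + g z) := by
  obtain ⟨H, h0, hH⟩ := hf
  obtain ⟨H', h0', hH'⟩ := hg
  exact ⟨H + H', by simp [h0, h0'], fun z hz => by beta_reduce; rw [hH z hz, hH' z hz, map_add, mul_add]⟩

lemma sum {ι : Type*} {s : Finset ι} {f : ι → ℂ → ℂ} (h : ∀ i ∈ s, IsRegularMultiple p e (f i)) :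
    IsRegularMultiple p e (fun z => ∑ i ∈ s, f i z) := by
  classical
  induction s using Finset.induction_on with
  | empty => simpa using zero
  | insert i s hi ih =>
    simp_rw [Finset.sum_insert hi]
    exact (h i (Finset.mem_insert_self i s)).add
      (ih fun j hj => h j (Finset.mem_insert_of_mem hj))

lemma mul (hf : IsRegularMultiple p e f) (hg : IsRegularMultiple p e' g) :
    IsRegularMultiple p (e + e') (fun z => f z * g z) := by
  obtain ⟨H, h0, hH⟩ := hf
  obtain ⟨H', h0', hH'⟩ := hg
  exact ⟨H * H', by simp [Polynomial.mul_coeff_zero, h0],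
    fun z hz => by beta_reduce; rw [hH z hz, hH' z hz, map_mul, pow_add]; ring⟩

lemma int_mul (c : ℤ) (hf : IsRegularMultiple p e f) :
    IsRegularMultiple p e (fun z => c * f z) := by
  obtain ⟨H, h0, hH⟩ := hf
  exact ⟨Polynomial.C c * H, by simp [h0], fun z hz => by
    beta_reduce
    rw [hH z hz, map_mul, Polynomial.aeval_C]
    simp
    ring⟩

lemma const_mul_scaledInv_pow {a : ℤ} (ha : (p : ℤ) ^ e ∣ a) {n : ℕ} (hn : n ≠ 0) :
    IsRegularMultiple p e (fun z => a * scaledInv p z ^ n) := by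
  obtain ⟨c, rfl⟩ := ha
  refine ⟨Polynomial.C c * Polynomial.X ^ n, by simp [Polynomial.coeff_X_pow, hn.symm], fun z _ => ?_⟩
  simp
  ring

end IsRegularMultiple

namespace IsMixed

variable {p : ℕ} {f g : ℂ → ℂ}

lemma congr (hf : IsMixed p f) (h : ∀ z : ℂ, 0 < z.im → g z = f z) : IsMixed p g := by
  obtain ⟨R, H, h0, hH⟩ := hf
  exact ⟨R, H, h0, fun z hz => (h z hz).trans (hH z hz)⟩

lemma int (c : ℤ) : IsMixed p (fun _ => c) := ⟨Polynomial.C c, 0, by simp, by simp⟩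

lemma add (hf : IsMixed p f) (hg : IsMixed p g) : IsMixed p (fun z => f z + g z) := by
  obtain ⟨R, H, h0, hH⟩ := hf
  obtain ⟨R', H', h0', hH'⟩ := hg
  exact ⟨R + R', H + H', by simp [h0, h0'], fun z hz => by
    beta_reduce
    rw [hH z hz, hH' z hz, map_add, map_add]; ring⟩

lemma int_mul (c : ℤ) (hf : IsMixed p f) : IsMixed p (fun z => c * f z) := by
  obtain ⟨R, H, h0, hH⟩ := hf
  refine ⟨Polynomial.C c * R, Polynomial.C c * H, by simp [h0], fun z hz => ?_⟩
  beta_reduce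
  rw [hH z hz]
  simp
  ring

lemma sub (hf : IsMixed p f) (hg : IsMixed p g) : IsMixed p (fun z => f z - g z) :=
  (hf.add (hg.int_mul (-1))).congr fun z _ => by push_cast; ring

lemma sum {ι : Type*} {s : Finset ι} {f : ι → ℂ → ℂ} (h : ∀ i ∈ s, IsMixed p (f i)) :
    IsMixed p (fun z => ∑ i ∈ s, f i z) := by
  classical
  induction s using Finset.induction_on with
  | empty => simpa using int (p := p) 0
  | insert i s hi ih =>
    simp_rw [Finset.sum_insert hi]
    exact (h i (Finset.mem_insert_self i s)).add
      (ih fun j hj => h j (Finset.mem_insert_of_mem hj))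

end IsMixed

lemma Polynomial.aeval_eq_mul_divX_add {A : Type*} [CommRing A] [Algebra ℤ A] (R : ℤ[X]) (t : A) :
    Polynomial.aeval t R = t * Polynomial.aeval t R.divX + (R.coeff 0 : A) := by
  conv_lhs => rw [← R.divX_mul_X_add]
  simp [mul_comm]

section

variable {p : ℕ} (hp : IsLevel p)
include hp

/-- The Fricke constant splits into the scaling of 1/Ψ, the divisibility retained by the regular
part, and one factor p to pay for the 1/p in U_p. -/
lemma IsLevel.exp_eq : 12 / (p - 1) = scaleExp p + (polarExp p + 1) := by
  rcases hp with rfl | rfl | rfl | rfl <;> rfl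

lemma fricke_div_etaQuot (z : ℂ) : (p : ℂ) ^ (12 / (p - 1)) / etaQuot p z =
    (p : ℂ) ^ (polarExp p + 1) * scaledInv p z := by
  rw [scaledInv, hp.exp_eq, pow_add]
  ring

lemma etaQuot_mul_scaledInv {z : ℂ} (hz : 0 < z.im) :
    etaQuot p z * scaledInv p z = (p : ℂ) ^ scaleExp p := by
  rw [scaledInv, mul_div_cancel₀ _ (etaQuot_ne_zero hp hz)]

/-- Each factor `scaledInv` of the regular part absorbs Ψ at the price of an integer; its linear
term becomes a constant and moves to the polynomial in Ψ. -/
lemma IsMixed.etaQuot_mul {f : ℂ → ℂ} (hf : IsMixed p f) :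
    IsMixed p (fun z => etaQuot p z * f z) := by
  obtain ⟨R, H, h0, hH⟩ := hf
  refine ⟨Polynomial.X * R + Polynomial.C ((p : ℤ) ^ (polarExp p + scaleExp p) * H.divX.coeff 0),
    Polynomial.C ((p : ℤ) ^ scaleExp p) * (Polynomial.X * H.divX.divX),
    by simp [Polynomial.mul_coeff_zero], fun z hz => ?_⟩
  beta_reduce
  rw [hH z hz, Polynomial.aeval_eq_mul_divX_add H, h0, Polynomial.aeval_eq_mul_divX_add H.divX]
  simp only [map_add, map_mul, Polynomial.aeval_X, Polynomial.aeval_C, map_pow, pow_add]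
  have h := etaQuot_mul_scaledInv hp hz
  simp only [algebraMap_int_eq, eq_intCast, Int.cast_natCast, Int.cast_zero]
  linear_combination (p : ℂ) ^ polarExp p * (scaledInv p z *
    (Polynomial.aeval (scaledInv p z)) H.divX.divX + (H.divX.coeff 0 : ℂ)) * h

lemma IsMixed.fricke_mul {f : ℂ → ℂ} (hf : IsMixed p f) :
    IsMixed p (fun z => (p : ℂ) ^ (12 / (p - 1)) / etaQuot p z * f z) := by
  obtain ⟨R, H, h0, hH⟩ := hf
  refine ⟨Polynomial.C ((p : ℤ) ^ (12 / (p - 1))) * R.divX,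
    Polynomial.X * (Polynomial.C (p * R.coeff 0) + Polynomial.C ((p : ℤ) ^ (polarExp p + 1)) * H),
    by simp [Polynomial.mul_coeff_zero], fun z hz => ?_⟩
  beta_reduce
  rw [hH z hz, Polynomial.aeval_eq_mul_divX_add R, fricke_div_etaQuot hp]
  simp only [map_add, map_mul, Polynomial.aeval_X, Polynomial.aeval_C, map_pow, hp.exp_eq, pow_add]
  have h := etaQuot_mul_scaledInv hp hz
  simp only [algebraMap_int_eq, eq_intCast, Int.cast_natCast]
  linear_combination (p : ℂ) ^ polarExp p * (p : ℂ) *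
    Polynomial.aeval (etaQuot p z) R.divX * h

lemma IsMixed.fricke_pow_mul {f : ℂ → ℂ} (hf : IsMixed p f) (n : ℕ) :
    IsMixed p (fun z => ((p : ℂ) ^ (12 / (p - 1)) / etaQuot p z) ^ n * f z) := by
  induction n with
  | zero => simpa using hf
  | succ n ih => exact (ih.fricke_mul hp).congr fun z _ => by ring

lemma IsMixed.translateCoeff_mul {f : ℂ → ℂ} (hf : IsMixed p f) (n : ℕ) : IsMixed p
    (fun z => translateCoeff p ((p : ℂ) ^ (12 / (p - 1)) / etaQuot p z) n * f z) := by
  simp_rw [translateCoeff, Finset.sum_mul, mul_assoc]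
  exact IsMixed.sum fun i _ => (hf.fricke_pow_mul hp _).int_mul _

lemma translateCoeff_zero (x : ℂ) : translateCoeff p x 0 = 1 := by
  rcases hp with rfl | rfl | rfl | rfl <;> simp [translateCoeff, conjCoeff]

/-- The modular equation times y^m, averaged over the translates y. Its coefficients depend on z
only and so come out of U_p. -/
lemma heckeU_etaQuot_pow_add {z : ℂ} (hz : 0 < z.im) (m : ℕ) :
    ∑ k ∈ Finset.range p, translateCoeff p ((p : ℂ) ^ (12 / (p - 1)) / etaQuot p z) k *
      heckeU p (fun z => etaQuot p z ^ (m + p - k)) z =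
      etaQuot p z * heckeU p (fun z => etaQuot p z ^ m) z := by
  simp only [heckeU, mul_div_assoc', ← Finset.sum_div, Finset.mul_sum]
  congr 1
  rw [Finset.sum_comm]
  refine Finset.sum_congr rfl fun j hj => ?_
  conv_rhs => rw [← translate_equation hp hz (Finset.mem_range.mp hj)]
  rw [Finset.sum_mul]
  refine Finset.sum_congr rfl fun k hk => ?_
  rw [mul_assoc, ← pow_add]
  have := Finset.mem_range.mp hk
  congr 2
  omega

lemma isMixed_heckeU_etaQuot_pow (n : ℕ) : IsMixed p (heckeU p fun z => etaQuot p z ^ n) := by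
  have hpc : (p : ℂ) ≠ 0 := by exact_mod_cast hp.ne_zero
  induction n using Nat.strong_induction_on with
  | _ n ih =>
    rcases Nat.eq_zero_or_pos n with rfl | hn0
    · refine (IsMixed.int (p := p) 1).congr fun z _ => ?_
      simp [heckeU, hpc]
    rcases lt_or_ge n p with hn | hn
    -- Below p the power sum is explicit: a constant minus p^{(`polarExp` + 1)n} `scaledInv`^n.
    -- After division by p, (`polarExp` + 1)(n - 1) + `polarExp` factors p remain.
    · refine ⟨Polynomial.C (coeff n (etaQuotSeries p hp.ne_zero ^ n)),
        Polynomial.C (-(p : ℤ) ^ ((polarExp p + 1) * (n - 1))) * Polynomial.X ^ n,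
        by simp [Polynomial.coeff_X_pow, hn0.ne], fun z hz => ?_⟩
      rw [heckeU, sum_etaQuot_pow hp hn0.ne' hn hz, fricke_div_etaQuot hp,
        ← coeff_etaQuotSeries_pow hp hn0.ne' hn, mul_pow, ← pow_mul]
      obtain ⟨k, rfl⟩ := Nat.exists_eq_succ_of_ne_zero hn0.ne'
      rw [Nat.succ_eq_add_one, Nat.add_sub_cancel, mul_add, mul_one, pow_add _ _ (polarExp p + 1),
        pow_succ _ (polarExp p)]
      simp
      field_simp
      ring
    · obtain ⟨m, rfl⟩ := Nat.exists_eq_add_of_le' hn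
      have hpos := hp.prime.pos
      refine IsMixed.congr (((ih m (by omega)).etaQuot_mul hp).sub
        (IsMixed.sum (s := (Finset.range p).erase 0) (f := fun k z =>
          translateCoeff p ((p : ℂ) ^ (12 / (p - 1)) / etaQuot p z) k *
            heckeU p (fun z => etaQuot p z ^ (m + p - k)) z) fun k hk =>
          (ih (m + p - k) ?_).translateCoeff_mul hp k)) fun z hz => ?_
      · have := Finset.mem_erase.mp hk
        have := Finset.mem_range.mp this.2
        omega
      · have h := heckeU_etaQuot_pow_add hp hz m
        rw [← Finset.add_sum_erase _ _ (Finset.mem_range.mpr hpos), translateCoeff_zero hp,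
          one_mul, Nat.sub_zero] at h
        exact eq_sub_of_add_eq h

end

/-! ### The action of U_p on powers of 1/Ψ -/

/-- The coefficients of the recursion for the sums of powers of the translates of `scaledInv`. -/
noncomputable def recCoeff (p m : ℕ) (z : ℂ) : ℂ :=
  (p : ℂ) ^ (scaleExp p * m) *
    translateCoeff p ((p : ℂ) ^ (12 / (p - 1)) / etaQuot p z) (p - m) / etaQuot p z

/-- The sum of the `i`-th powers of the translates of `scaledInv`. -/
noncomputable def scaledInvSum (p i : ℕ) (z : ℂ) : ℂ :=
  ∑ j ∈ Finset.range p, scaledInv p ((z + (j : ℤ)) / p) ^ i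

section

variable {p : ℕ} (hp : IsLevel p)
include hp

/-- A finite check, and the source of `gainExp`. The factor m is indispensable: for p = 2, m = 2, i
= 0 and for p = 3, m = 3, i = 0 the required power is attained exactly. -/
lemma pow_gainExp_dvd {m i : ℕ} (hm0 : m ≠ 0) (hm : m ≤ p) (hi : i ≤ p - m) :
    (p : ℤ) ^ (gainExp p + 1) ∣ m * ((p : ℤ) ^ (scaleExp p * (m - 1)) * (conjCoeff p).getD i 0 *
      (p : ℤ) ^ ((polarExp p + 1) * (p - m - i))) := by
  have key : ∀ p ∈ ([2, 3, 5, 7] : List ℕ), ∀ m < p + 1, m ≠ 0 → ∀ i < p - m + 1,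
      (p : ℤ) ^ (gainExp p + 1) ∣ m * ((p : ℤ) ^ (scaleExp p * (m - 1)) * (conjCoeff p).getD i 0 *
        (p : ℤ) ^ ((polarExp p + 1) * (p - m - i))) := by decide
  refine key p ?_ m (by omega) hm0 i (by omega)
  rcases hp with rfl | rfl | rfl | rfl <;> simp

lemma natCast_mul_recCoeff {m : ℕ} (hm0 : m ≠ 0) (a : ℤ) {z : ℂ} (hz : 0 < z.im) :
    a * recCoeff p m z = ∑ i ∈ Finset.range (p - m + 1),
      ((a * ((p : ℤ) ^ (scaleExp p * (m - 1)) * (conjCoeff p).getD i 0 *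
        (p : ℤ) ^ ((polarExp p + 1) * (p - m - i))) : ℤ) : ℂ) * scaledInv p z ^ (p - m - i + 1) := by
  have hΨ := etaQuot_ne_zero hp hz
  rw [recCoeff, translateCoeff, Finset.mul_sum, Finset.sum_div, Finset.mul_sum]
  refine Finset.sum_congr rfl fun i _ => ?_
  obtain ⟨m, rfl⟩ := Nat.exists_eq_succ_of_ne_zero hm0
  rw [fricke_div_etaQuot hp, mul_pow, ← pow_mul, Nat.succ_eq_add_one, Nat.add_sub_cancel, mul_add,
    mul_one, pow_add _ _ (scaleExp p), pow_succ (scaledInv p z)]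
  rw [show ∀ A, A * scaledInv p z = A * ((p : ℂ) ^ scaleExp p / etaQuot p z) from fun _ => rfl]
  push_cast
  field_simp

lemma isRegularMultiple_recCoeff {m : ℕ} (hm0 : m ≠ 0) : IsRegularMultiple p 0 (recCoeff p m) := by
  refine (IsRegularMultiple.sum (s := Finset.range (p - m + 1)) fun i _ =>
    IsRegularMultiple.const_mul_scaledInv_pow (a := 1 * ((p : ℤ) ^ (scaleExp p * (m - 1)) *
      (conjCoeff p).getD i 0 * (p : ℤ) ^ ((polarExp p + 1) * (p - m - i))))
      (n := p - m - i + 1) (by simp) (by omega)).congr fun z hz => ?_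
  have := natCast_mul_recCoeff hp hm0 1 hz
  rwa [Int.cast_one, one_mul] at this

lemma isRegularMultiple_mul_recCoeff {m : ℕ} (hm0 : m ≠ 0) (hm : m ≤ p) :
    IsRegularMultiple p (gainExp p + 1) (fun z => m * recCoeff p m z) := by
  refine (IsRegularMultiple.sum (s := Finset.range (p - m + 1)) fun i hi => IsRegularMultiple.const_mul_scaledInv_pow
    (pow_gainExp_dvd hp hm0 hm (Nat.le_of_lt_succ (Finset.mem_range.mp hi)))
    (n := p - m - i + 1) (by omega)).congr fun z hz => ?_
  exact_mod_cast natCast_mul_recCoeff hp hm0 m hz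

/-- The modular equation for y divided by Ψ(z) y^i, suitably scaled and summed over the translates.
Terms with p - k < i are again sums of negative powers of y. -/
lemma scaledInvSum_eq {i : ℕ} {z : ℂ} (hz : 0 < z.im) :
    scaledInvSum p i z = ∑ k ∈ Finset.range p, recCoeff p (p - k) z *
      ((p : ℂ) ^ (scaleExp p * i) / (p : ℂ) ^ (scaleExp p * (p - k)) *
        ∑ j ∈ Finset.range p, etaQuot p ((z + (j : ℤ)) / p) ^ (p - k) /
          etaQuot p ((z + (j : ℤ)) / p) ^ i) := by
  have hpc : (p : ℂ) ≠ 0 := by exact_mod_cast hp.ne_zero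
  have hΨ := etaQuot_ne_zero hp hz
  simp_rw [Finset.mul_sum]
  rw [Finset.sum_comm]
  refine Finset.sum_congr rfl fun j hj => ?_
  have hy := etaQuot_ne_zero hp (im_add_intCast_div hp.ne_zero hz j)
  have h := translate_equation hp hz (Finset.mem_range.mp hj)
  have h1 : scaledInv p ((z + (j : ℤ)) / p) ^ i = (p : ℂ) ^ (scaleExp p * i) / etaQuot p z /
      etaQuot p ((z + (j : ℤ)) / p) ^ i * etaQuot p z := by
    rw [scaledInv, div_pow, pow_mul]
    field_simp
  rw [h1]
  refine (congrArg (fun t => _ * t) h.symm).trans ?_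
  rw [Finset.mul_sum]
  refine Finset.sum_congr rfl fun k hk => ?_
  have := Finset.mem_range.mp hk
  rw [recCoeff, Nat.sub_sub_self this.le]
  field_simp

lemma scaledInvSum_term {i k : ℕ} (hik : p - k < i) {z : ℂ} (hz : 0 < z.im) :
    (p : ℂ) ^ (scaleExp p * i) / (p : ℂ) ^ (scaleExp p * (p - k)) *
        ∑ j ∈ Finset.range p, etaQuot p ((z + (j : ℤ)) / p) ^ (p - k) /
          etaQuot p ((z + (j : ℤ)) / p) ^ i = scaledInvSum p (i - (p - k)) z := by
  have hpc : (p : ℂ) ≠ 0 := by exact_mod_cast hp.ne_zero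
  rw [scaledInvSum, Finset.mul_sum]
  refine Finset.sum_congr rfl fun j _ => ?_
  have hy := etaQuot_ne_zero hp (im_add_intCast_div hp.ne_zero hz j)
  obtain ⟨l, rfl⟩ := Nat.exists_eq_add_of_lt hik
  rw [show p - k + l + 1 - (p - k) = l + 1 by omega, scaledInv, div_pow, ← pow_mul, add_assoc,
    mul_add, pow_add, pow_add _ (p - k)]
  field_simp

/-- The terms with nonnegative powers of y collapse by Newton's identity: those with k < p - i give
-(p - i) times the coefficient of index p - i, and k = p - i gives p times it, leaving i times it.
-/
lemma scaledInvSum_initial {i : ℕ} (hi0 : i ≠ 0) (hi : i ≤ p) {z : ℂ} (hz : 0 < z.im) :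
    ∑ k ∈ Finset.range (p - i + 1), recCoeff p (p - k) z *
      ((p : ℂ) ^ (scaleExp p * i) / (p : ℂ) ^ (scaleExp p * (p - k)) *
        ∑ j ∈ Finset.range p, etaQuot p ((z + (j : ℤ)) / p) ^ (p - k) /
          etaQuot p ((z + (j : ℤ)) / p) ^ i) = i * recCoeff p i z := by
  have hpc : (p : ℂ) ≠ 0 := by exact_mod_cast hp.ne_zero
  have hΨ := etaQuot_ne_zero hp hz
  set x := (p : ℂ) ^ (12 / (p - 1)) / etaQuot p z
  have hN := newton_translateCoeff hp (n := p - i) (by omega) x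
  have hterm : ∀ k ∈ Finset.range (p - i), recCoeff p (p - k) z *
      ((p : ℂ) ^ (scaleExp p * i) / (p : ℂ) ^ (scaleExp p * (p - k)) *
        ∑ j ∈ Finset.range p, etaQuot p ((z + (j : ℤ)) / p) ^ (p - k) /
          etaQuot p ((z + (j : ℤ)) / p) ^ i) = (p : ℂ) ^ (scaleExp p * i) / etaQuot p z *
      (translateCoeff p x k * (((conjPowerSum p).getD (p - i - k) 0 : ℤ) - x ^ (p - i - k))) := by
    intro k hk
    have hk := Finset.mem_range.mp hk
    rw [← sum_etaQuot_pow hp (by omega) (by omega) hz, recCoeff, Nat.sub_sub_self (by omega)]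
    have : ∀ j ∈ Finset.range p, etaQuot p ((z + (j : ℤ)) / p) ^ (p - k) /
        etaQuot p ((z + (j : ℤ)) / p) ^ i = etaQuot p ((z + (j : ℤ)) / p) ^ (p - i - k) := by
      intro j _
      have hy := etaQuot_ne_zero hp (im_add_intCast_div hp.ne_zero hz j)
      rw [div_eq_iff (pow_ne_zero _ hy), ← pow_add]
      congr 1
      omega
    rw [Finset.sum_congr rfl this]
    field_simp
    exact mul_comm _ _
  have hlast : ∀ j ∈ Finset.range p, etaQuot p ((z + (j : ℤ)) / p) ^ i /
        etaQuot p ((z + (j : ℤ)) / p) ^ i = 1 := fun j _ =>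
    div_self (pow_ne_zero _ (etaQuot_ne_zero hp (im_add_intCast_div hp.ne_zero hz j)))
  rw [Finset.sum_range_succ, Finset.sum_congr rfl hterm, ← Finset.mul_sum,
    eq_neg_of_add_eq_zero_right hN, Nat.sub_sub_self hi, Finset.sum_congr rfl hlast,
    Finset.sum_const, Finset.card_range, nsmul_eq_mul, recCoeff, Nat.cast_sub hi]
  field_simp
  ring

/-- The recursion has integral coefficients, so the divisibility propagates by induction; it enters
only through the initial terms i · `recCoeff p i` with i ≤ p. The extra factor p pays for the 1/p in
U_p. -/
lemma isRegularMultiple_scaledInvSum {i : ℕ} (hi0 : i ≠ 0) :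
    IsRegularMultiple p (gainExp p + 1) (scaledInvSum p i) := by
  induction i using Nat.strong_induction_on with
  | _ i ih =>
    have hterm : ∀ k, k < p → p - k < i → IsRegularMultiple p (gainExp p + 1) fun z =>
        recCoeff p (p - k) z * scaledInvSum p (i - (p - k)) z := fun k hk hki => by
      simpa using (isRegularMultiple_recCoeff hp (m := p - k) (by omega)).mul
        (ih (i - (p - k)) (by omega) (by omega))
    rcases le_or_gt i p with hi | hi
    · refine ((isRegularMultiple_mul_recCoeff hp hi0 hi).add (IsRegularMultiple.sum
        (s := Finset.Ico (p - i + 1) p) (f := fun k z => recCoeff p (p - k) z *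
          scaledInvSum p (i - (p - k)) z) fun k hk => ?_)).congr fun z hz => ?_
      · have := Finset.mem_Ico.mp hk
        exact hterm k (by omega) (by omega)
      · rw [scaledInvSum_eq hp hz, ← Finset.sum_range_add_sum_Ico _ (show p - i + 1 ≤ p by omega),
          scaledInvSum_initial hp hi0 hi hz]
        congr 1
        refine Finset.sum_congr rfl fun k hk => ?_
        have := Finset.mem_Ico.mp hk
        rw [scaledInvSum_term hp (by omega) hz]
    · refine (IsRegularMultiple.sum (s := Finset.range p) (f := fun k z => recCoeff p (p - k) z *
          scaledInvSum p (i - (p - k)) z) fun k hk => ?_).congr fun z hz => ?_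
      · have := Finset.mem_range.mp hk
        exact hterm k (by omega) (by omega)
      · rw [scaledInvSum_eq hp hz]
        refine Finset.sum_congr rfl fun k hk => ?_
        have := Finset.mem_range.mp hk
        rw [scaledInvSum_term hp (by omega) hz]

lemma isRegularMultiple_heckeU_scaledInv_pow {i : ℕ} (hi0 : i ≠ 0) :
    IsRegularMultiple p (gainExp p) (heckeU p fun z => scaledInv p z ^ i) := by
  have hpc : (p : ℂ) ≠ 0 := by exact_mod_cast hp.ne_zero
  obtain ⟨H, h0, hH⟩ := isRegularMultiple_scaledInvSum hp hi0
  refine ⟨H, h0, fun z hz => ?_⟩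
  have := hH z hz
  rw [scaledInvSum] at this
  rw [heckeU, this, pow_succ]
  field_simp

omit hp in
lemma heckeU_aeval (g : ℂ → ℂ) (H : ℤ[X]) (z : ℂ) :
    heckeU p (fun z => Polynomial.aeval (g z) H) z =
      ∑ n ∈ H.support, H.coeff n * heckeU p (fun z => g z ^ n) z := by
  simp only [heckeU, mul_div_assoc', ← Finset.sum_div, Finset.mul_sum]
  rw [Finset.sum_comm]
  simp [Polynomial.aeval_def, Polynomial.eval₂_eq_sum, Polynomial.sum_def]

omit hp in
lemma heckeU_congr (hp0 : p ≠ 0) {f g : ℂ → ℂ} (h : ∀ z : ℂ, 0 < z.im → f z = g z) {z : ℂ}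
    (hz : 0 < z.im) : heckeU p f z = heckeU p g z := by
  rw [heckeU, heckeU]
  exact congrArg (· / (p : ℂ))
    (Finset.sum_congr rfl fun j _ => h _ (im_add_intCast_div hp0 hz j))

omit hp in
lemma heckeU_const_mul (c : ℂ) (f : ℂ → ℂ) (z : ℂ) :
    heckeU p (fun z => c * f z) z = c * heckeU p f z := by
  rw [heckeU, heckeU, ← Finset.mul_sum, mul_div_assoc]

lemma IsRegularMultiple.heckeU {e : ℕ} {f : ℂ → ℂ} (hf : IsRegularMultiple p e f) :
    IsRegularMultiple p (e + gainExp p) (heckeU p f) := by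
  obtain ⟨H, h0, hH⟩ := hf
  obtain ⟨G, hG0, hG⟩ := IsRegularMultiple.sum (s := H.support) fun n hn =>
    (isRegularMultiple_heckeU_scaledInv_pow hp (i := n) (by
      rintro rfl
      exact Polynomial.mem_support_iff.mp hn h0)).int_mul (H.coeff n)
  refine ⟨G, hG0, fun z hz => ?_⟩
  have hGz := hG z hz
  beta_reduce at hGz
  rw [heckeU_congr hp.ne_zero hH hz, heckeU_const_mul, heckeU_aeval, hGz, pow_add, mul_assoc]

lemma isMixed_heckeU_aeval (R : ℤ[X]) :
    IsMixed p (heckeU p fun z => Polynomial.aeval (etaQuot p z) R) :=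
  (IsMixed.sum fun n _ => (isMixed_heckeU_etaQuot_pow hp n).int_mul (R.coeff n)).congr
    fun z _ => heckeU_aeval _ R z

end

/-! ### Divisibility of the coefficients of regular functions -/

lemma IsSeries.add {a b : PowerSeries ℂ} {F G : ℂ → ℂ} (ha : IsSeries a F) (hb : IsSeries b G) :
    IsSeries (a + b) (fun q => F q + G q) := fun q hq => by
  simpa only [map_add, add_mul] using (ha q hq).add (hb q hq)

lemma IsSeries.int_mul {a : PowerSeries ℂ} {F : ℂ → ℂ} (ha : IsSeries a F) (c : ℤ) :
    IsSeries (PowerSeries.C (c : ℂ) * a) (fun q => c * F q) := fun q hq => by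
  simpa only [PowerSeries.coeff_C_mul, mul_assoc] using (ha q hq).mul_left (c : ℂ)

lemma IsSeries.X : IsSeries PowerSeries.X fun q => q := fun q _ => by
  convert hasSum_ite_eq (1 : ℕ) q using 2 with n
  rw [PowerSeries.coeff_X]
  split_ifs with h <;> simp [h]

lemma IsSeries.aeval {a : PowerSeries ℤ} {F : ℂ → ℂ}
    (ha : IsSeries (a.map (Int.castRingHom ℂ)) F) (H : ℤ[X]) :
    IsSeries ((Polynomial.aeval a H).map (Int.castRingHom ℂ))
      (fun q => Polynomial.aeval (F q) H) := by
  induction H using Polynomial.induction_on' with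
  | add P Q hP hQ => simpa only [map_add] using hP.add hQ
  | monomial n c =>
    have := (ha.pow n).int_mul c
    simpa [Polynomial.aeval_monomial] using this

section

variable {p : ℕ} (hp : IsLevel p)
include hp

/-- The expansion of a regular multiple. -/
lemma IsRegularMultiple.exists_hasSum {e : ℕ} {f : ℂ → ℂ} (hf : IsRegularMultiple p e f) :
    ∃ c : ℕ → ℤ, (∀ n, (p : ℤ) ^ (e + scaleExp p) ∣ c n) ∧
      ∀ z : ℂ, 0 < z.im → HasSum (fun n : ℕ => (c n : ℂ) * qParam 1 z ^ n) (f z) := by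
  obtain ⟨H, h0, hH⟩ := hf
  set u : PowerSeries ℤ := PowerSeries.invOfUnit (etaQuotSeries p hp.ne_zero) 1
  have hu : etaQuotSeries p hp.ne_zero * u = 1 :=
    PowerSeries.mul_invOfUnit _ _ (constantCoeff_etaQuotSeries hp)
  have h1 := (isSeries_etaQuotReg hp).inv hu (differentiableOn_etaQuotReg hp)
    fun _ => etaQuotReg_ne_zero hp
  have h2 := (IsSeries.X.mul h1).int_mul (p ^ scaleExp p)
  have h3 : PowerSeries.C (((p : ℤ) ^ scaleExp p : ℤ) : ℂ) *
      (PowerSeries.X * u.map (Int.castRingHom ℂ)) =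
      (PowerSeries.C ((p : ℤ) ^ scaleExp p) * (PowerSeries.X * u)).map (Int.castRingHom ℂ) := by
    simp
  rw [h3] at h2
  have h4 := (h2.aeval H).int_mul (p ^ e)
  set v : PowerSeries ℤ := PowerSeries.C ((p : ℤ) ^ scaleExp p) * (PowerSeries.X * u)
  -- Without a constant term, H(v) is a multiple of v and inherits its factor p^`scaleExp`.
  obtain ⟨w, hw⟩ : v ∣ Polynomial.aeval v H := by
    rw [Polynomial.aeval_eq_mul_divX_add, h0, Int.cast_zero, add_zero]
    exact dvd_mul_right _ _
  refine ⟨fun n => (p : ℤ) ^ e * coeff n (Polynomial.aeval v H), fun n => ?_, fun z hz => ?_⟩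
  · simp only [hw, v]
    rw [mul_assoc, PowerSeries.coeff_C_mul, pow_add]
    exact mul_dvd_mul_left _ (dvd_mul_right _ _)
  · have h5 := h4 _ (norm_qParam_one_lt hz)
    simp only [PowerSeries.coeff_C_mul, PowerSeries.coeff_map, eq_intCast] at h5
    rw [hH z hz, scaledInv, etaQuot_eq hp]
    have h6 : (p : ℂ) ^ scaleExp p / ((qParam 1 z)⁻¹ * etaQuotReg p (qParam 1 z)) =
        (((p : ℤ) ^ scaleExp p : ℤ) : ℂ) * (qParam 1 z * (etaQuotReg p (qParam 1 z))⁻¹) := by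
      push_cast
      rw [div_eq_mul_inv, mul_inv, inv_inv]
    rw [h6]
    push_cast at h5 ⊢
    exact h5

omit hp in
lemma hasSum_heckeU (hp : p ≠ 0) {c : ℕ → ℂ} {F : ℂ → ℂ}
    (h : ∀ z : ℂ, 0 < z.im → HasSum (fun n : ℕ => c n * qParam 1 z ^ n) (F z)) {z : ℂ}
    (hz : 0 < z.im) : HasSum (fun n : ℕ => c (p * n) * qParam 1 z ^ n) (heckeU p F z) := by
  have h1 : LaurentExp (shiftCoeff 0 c) F := laurentExp_shiftCoeff fun z hz => by simpa using h z hz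
  have h2 := (h1.heckeU hp).hasSum_nat (fun n hn => by
    have : (p : ℤ) * n < 0 := mul_neg_of_pos_of_neg (by exact_mod_cast hp.bot_lt) hn
    simp [shiftCoeff, this]) hz
  refine (congrArg (HasSum · _) (funext fun n => ?_)).mp h2
  have h3 : (p : ℤ) * n = ((p * n : ℕ) : ℤ) := by push_cast; rfl
  rw [h3, shiftCoeff, if_pos (by positivity), Nat.cast_zero, add_zero, Int.toNat_natCast]

lemma IsRegularMultiple.pow_dvd_coeff {e k : ℕ} {f : ℂ → ℂ} (hf : IsRegularMultiple p e f)
    {c : ℕ → ℤ} (hc : ∀ z : ℂ, 0 < z.im → HasSum (fun n : ℕ => (c n : ℂ) * qParam 1 z ^ n) (f z))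
    (n : ℕ) : (p : ℤ) ^ (e + gainExp p * k + scaleExp p) ∣ c (p ^ k * n) := by
  induction k generalizing e f c with
  | zero =>
    obtain ⟨c', hd, hc'⟩ := hf.exists_hasSum hp
    have : c' = c := funext fun n => by exact_mod_cast congrFun (coeff_unique_of_hasSum hc' hc) n
    simpa [← this] using hd n
  | succ k ih =>
    have := ih (hf.heckeU hp) (c := fun n => c (p * n)) fun z hz => hasSum_heckeU hp.ne_zero hc hz
    rw [pow_succ', mul_assoc, mul_add, mul_one]
    rwa [show e + (gainExp p * k + gainExp p) + scaleExp p =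
      e + gainExp p + gainExp p * k + scaleExp p by ring]

/-- |Ψ| tends to infinity at the cusp, so a nonconstant polynomial in Ψ is unbounded there. -/
lemma eq_const_of_tendsto_eval {R : ℂ[X]} {c : ℂ}
    (h : Tendsto (fun τ : ℍ => R.eval (etaQuot p τ)) UpperHalfPlane.atImInfty (𝓝 c)) :
    R = Polynomial.C c := by
  have h1 : Tendsto (fun τ : ℍ => ‖etaQuot p τ‖) UpperHalfPlane.atImInfty atTop := by
    have h2 : Tendsto (fun τ : ℍ => ‖(etaQuot p τ)⁻¹‖) UpperHalfPlane.atImInfty (𝓝[>] 0) :=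
      tendsto_nhdsWithin_iff.mpr ⟨by simpa using (tendsto_inv_etaQuot hp).norm,
        .of_forall fun τ => norm_pos_iff.mpr (inv_ne_zero (etaQuot_ne_zero hp τ.im_pos))⟩
    refine h2.inv_tendsto_nhdsGT_zero.congr fun τ => ?_
    simp
  have h3 : R.degree ≤ 0 := by
    by_contra hR
    exact not_tendsto_nhds_of_tendsto_atTop
      (R.tendsto_norm_atTop (not_le.mp hR) h1) _ h.norm
  rw [Polynomial.eq_C_of_degree_le_zero h3] at h ⊢
  simp only [Polynomial.eval_C] at h
  rw [tendsto_nhds_unique tendsto_const_nhds h]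

end

/-! ### Polar expansions, the basis functions and the congruences -/

/-- `F` is the sum of `q ^ (-m)` and the power series in `q` with coefficients `a`. -/
def PolarExp (m : ℕ) (a : ℕ → ℂ) (F : ℂ → ℂ) : Prop :=
  ∀ z : ℂ, 0 < z.im → HasSum (fun n : ℕ => a n * qParam 1 z ^ n) (F z - qParam 1 z ^ (-(m : ℤ)))

lemma PolarExp.hasSum_heckeU {p m : ℕ} (hp : p ≠ 0) {a : ℕ → ℂ} {F : ℂ → ℂ} (h : PolarExp m a F)
    {z : ℂ} (hz : 0 < z.im) : HasSum (fun n : ℕ => a (p * n) * qParam 1 z ^ n)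
      (heckeU p F z - if (p : ℤ) ∣ -(m : ℤ) then qParam 1 z ^ (-(m : ℤ) / p) else 0) := by
  have hpc : (p : ℂ) ≠ 0 := by exact_mod_cast hp
  refine (congrArg (HasSum _ ·) ?_).mp (_root_.hasSum_heckeU hp h hz)
  rw [heckeU, heckeU, Finset.sum_sub_distrib, sum_qParam_zpow hp, sub_div]
  split_ifs
  · rw [mul_div_cancel_left₀ _ hpc]
  · rw [zero_div]

lemma aeval_eq_eval_map (t : ℂ) (R : ℤ[X]) :
    Polynomial.aeval t R = (R.map (Int.castRingHom ℂ)).eval t := by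
  rw [Polynomial.eval_map, Polynomial.aeval_def]
  rfl

section

variable {p : ℕ} (hp : IsLevel p)
include hp

lemma exists_regular_part (R : ℤ[X]) : ∃ (R' : ℤ[X]) (f : ℂ → ℂ) (c : ℕ → ℤ),
    IsRegularMultiple p (polarExp p) f ∧
    (∀ z : ℂ, 0 < z.im → HasSum (fun n : ℕ => (c n : ℂ) * qParam 1 z ^ n) (f z)) ∧
    ∀ z : ℂ, 0 < z.im → heckeU p (fun z => Polynomial.aeval (etaQuot p z) R) z =
      Polynomial.aeval (etaQuot p z) R' + f z := by
  obtain ⟨R', H, hH0, hRH⟩ := isMixed_heckeU_aeval hp R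
  have hreg : IsRegularMultiple p (polarExp p)
      fun z => (p : ℂ) ^ polarExp p * Polynomial.aeval (scaledInv p z) H :=
    ⟨H, hH0, fun _ _ => rfl⟩
  obtain ⟨c, -, hc⟩ := hreg.exists_hasSum hp
  exact ⟨R', _, c, hreg, hc, hRH⟩

/-- Induction on α: U_p returns a polynomial in Ψ with pole order divided by p, plus a regular part.
For α = 0 the pole disappears, the polynomial is constant, and only the regular part reaches the
coefficients of index n ≥ 1. -/
theorem PolarExp.pow_dvd_coeff (α : ℕ) {m' : ℕ} (hm' : ¬ p ∣ m') {a : ℕ → ℤ} {R : ℤ[X]}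
    (h : PolarExp (p ^ α * m') (fun n => (a n : ℂ)) fun z => Polynomial.aeval (etaQuot p z) R)
    {k n : ℕ} (hn : 1 ≤ n) :
    (p : ℤ) ^ (polarExp p + gainExp p * k + scaleExp p) ∣ a (p ^ (α + 1 + k) * n) := by
  have hpos : ∀ j, 1 ≤ p ^ j * n := fun j => Nat.mul_pos (pow_pos hp.prime.pos _) hn
  have hpz : (p : ℤ) ≠ 0 := by exact_mod_cast hp.ne_zero
  induction α generalizing k a R with
  | zero =>
    obtain ⟨R', f, c, hreg, hc, hRf⟩ := exists_regular_part hp R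
    have hnd : ¬ (p : ℤ) ∣ -((p ^ 0 * m' : ℕ) : ℤ) := by
      rw [dvd_neg, pow_zero, one_mul]
      exact_mod_cast hm'
    have h1 : ∀ z : ℂ, 0 < z.im → HasSum (fun n => ((a (p * n) - c n : ℤ) : ℂ) * qParam 1 z ^ n)
        (Polynomial.aeval (etaQuot p z) R') := fun z hz => by
      have := (h.hasSum_heckeU hp.ne_zero hz).sub (hc z hz)
      rw [if_neg hnd, sub_zero, hRf z hz, add_sub_cancel_right] at this
      simpa only [Int.cast_sub, sub_mul] using this
    have h2 := tendsto_atImInfty_of_hasSum h1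
    simp only [aeval_eq_eval_map] at h2
    have h3 := eq_const_of_tendsto_eval hp h2
    have h4 : ∀ z : ℂ, 0 < z.im → HasSum
        (fun n : ℕ => (if n = 0 then ((a (p * 0) - c 0 : ℤ) : ℂ) else 0) * qParam 1 z ^ n)
        (Polynomial.aeval (etaQuot p z) R') := fun z _ => by
      rw [aeval_eq_eval_map, h3, Polynomial.eval_C]
      convert hasSum_ite_eq (0 : ℕ) ((a (p * 0) - c 0 : ℤ) : ℂ) using 2 with n
      split_ifs with hn <;> simp [hn]
    have h5 : ∀ n, 1 ≤ n → a (p * n) = c n := fun n hn => by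
      have := congrFun (coeff_unique_of_hasSum h1 h4) n
      rw [if_neg (by omega)] at this
      exact sub_eq_zero.mp (by exact_mod_cast this)
    rw [zero_add, pow_add p, pow_one, mul_assoc, h5 _ (hpos k)]
    exact hreg.pow_dvd_coeff hp hc n
  | succ α ih =>
    obtain ⟨R', f, c, hreg, hc, hRf⟩ := exists_regular_part hp R
    have h1 : PolarExp (p ^ α * m') (fun n => ((a (p * n) - c n : ℤ) : ℂ))
        fun z => Polynomial.aeval (etaQuot p z) R' := fun z hz => by
      have := (h.hasSum_heckeU hp.ne_zero hz).sub (hc z hz)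
      have hm : -((p ^ (α + 1) * m' : ℕ) : ℤ) = p * -((p ^ α * m' : ℕ) : ℤ) := by
        push_cast
        ring
      rw [hm, if_pos (dvd_mul_right _ _), Int.mul_ediv_cancel_left _ hpz, hRf z hz] at this
      refine (congrArg₂ HasSum (funext fun n => ?_) ?_).mp this
      · push_cast
        ring
      · ring
    -- The regular part split off at this stage still undergoes α + 1 + k applications of U_p, at
    -- least the k that the claim requires.
    have h2 := dvd_add (ih h1 (k := k)) ((pow_dvd_pow (p : ℤ) (by gcongr; omega)).trans
      (hreg.pow_dvd_coeff hp hc (k := α + 1 + k) n))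
    rw [show α + 1 + 1 + k = (α + 1 + k) + 1 by ring, pow_succ' p, mul_assoc]
    simpa using h2

/-- The function with a given pole at the cusp, as an integral polynomial in `etaQuot p`. -/
theorem exists_polarExp {m : ℕ} (hm : 1 ≤ m) : ∃ (Q : ℤ[X]) (a : ℕ → ℤ),
    Q.degree < (m : WithBot ℕ) ∧ Q.coeff 0 = 0 ∧ PolarExp m (fun n => (a n : ℂ))
      fun z => etaQuot p z ^ m - Polynomial.aeval (etaQuot p z) Q := by
  induction m using Nat.strong_induction_on with
  | _ m ih =>
    choose! Q a hdeg hQ0 hQ using ih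
    set b : ℕ → ℤ := fun n => coeff n (etaQuotSeries p hp.ne_zero ^ m)
    -- The coefficient b k of q^{k-m} in Ψ^m is cancelled by b k times the function of pole order m
    -- - k. Since k < m, no constant term enters.
    refine ⟨∑ k ∈ Finset.Ico 1 m, Polynomial.C (b k) * (Polynomial.X ^ (m - k) - Q (m - k)),
      fun n => b (n + m) - ∑ k ∈ Finset.Ico 1 m, b k * a (m - k) n, ?_, ?_, fun z hz => ?_⟩
    · refine (Polynomial.degree_sum_le _ _).trans_lt ?_
      refine (Finset.sup_lt_iff (WithBot.bot_lt_coe m)).mpr fun k hk => ?_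
      obtain ⟨h1, h2⟩ := Finset.mem_Ico.mp hk
      have h3 : (Polynomial.X ^ (m - k) - Q (m - k)).degree ≤ ((m - k : ℕ) : WithBot ℕ) :=
        (Polynomial.degree_sub_le _ _).trans (max_le (Polynomial.degree_X_pow_le _)
          (hdeg _ (by omega) (by omega)).le)
      rw [← Polynomial.smul_eq_C_mul]
      exact ((Polynomial.degree_smul_le _ _).trans h3).trans_lt (Nat.cast_lt.mpr (by omega))
    · rw [Polynomial.finsetSum_coeff]
      refine Finset.sum_eq_zero fun k hk => ?_
      obtain ⟨h1, h2⟩ := Finset.mem_Ico.mp hk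
      rw [Polynomial.coeff_C_mul, Polynomial.coeff_sub, hQ0 _ (by omega) (by omega),
        Polynomial.coeff_X_pow, if_neg (by omega), sub_zero, mul_zero]
    · have hq : qParam 1 z ≠ 0 := Function.Periodic.qParam_ne_zero z
      have h1 := (isSeries_etaQuotReg hp).pow m _ (norm_qParam_one_lt hz)
      rw [← map_pow] at h1
      simp only [PowerSeries.coeff_map, eq_intCast] at h1
      have h2 := ((hasSum_nat_add_iff' m).mpr h1).mul_left (qParam 1 z ^ (-(m : ℤ)))
      have h3 := hasSum_sum fun k (hk : k ∈ Finset.Ico 1 m) => by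
        have := Finset.mem_Ico.mp hk
        exact (hQ (m - k) (by omega) (by omega) z hz).mul_left (b k : ℂ)
      refine (congrArg₂ HasSum (funext fun n => ?_) ?_).mp (h2.sub h3)
      · rw [zpow_neg, zpow_natCast, pow_add]
        push_cast
        rw [sub_mul, Finset.sum_mul]
        congr 1
        · field_simp
          rfl
        · exact Finset.sum_congr rfl fun k _ => (mul_assoc _ _ _).symm
      · have hb0 : (coeff 0 (etaQuotSeries p hp.ne_zero ^ m) : ℤ) = 1 := by
          simp [constantCoeff_etaQuotSeries hp]
        rw [Finset.range_eq_Ico, Finset.sum_eq_sum_Ico_succ_bot (by omega), hb0]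
        beta_reduce
        rw [map_sum]
        simp only [map_mul, map_sub, map_pow, Polynomial.aeval_X, zero_add, pow_zero, mul_one,
          Int.cast_one, mul_sub, Finset.sum_sub_distrib, eq_intCast, map_intCast]
        have h4 : ∀ k ∈ Finset.Ico 1 m, (b k : ℂ) * qParam 1 z ^ (-((m - k : ℕ) : ℤ)) =
            qParam 1 z ^ (-(m : ℤ)) * (b k * qParam 1 z ^ k) := fun k hk => by
          rw [Nat.cast_sub (Finset.mem_Ico.mp hk).2.le, neg_sub, sub_eq_add_neg, zpow_add₀ hq,
            zpow_natCast]
          ring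
        rw [Finset.sum_congr rfl h4, ← Finset.mul_sum]
        have h5 : etaQuot p z ^ m =
            qParam 1 z ^ (-(m : ℤ)) * etaQuotReg p (qParam 1 z) ^ m := by
          rw [etaQuot_eq hp, mul_pow, zpow_neg, zpow_natCast, inv_pow]
        rw [h5]
        simp only [b]
        ring

/-- The difference of the two polynomials in Ψ has no pole, so it is constant; the normalization of
the constant terms makes it zero. -/
lemma eq_of_polarExp {m : ℕ} {Q R : ℂ[X]} (hQ0 : Q.coeff 0 = 0) (hR0 : R.coeff 0 = 0)
    {a b : ℕ → ℂ} (hQ : PolarExp m a fun z => etaQuot p z ^ m - Q.eval (etaQuot p z))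
    (hR : PolarExp m b fun z => etaQuot p z ^ m - R.eval (etaQuot p z)) : Q = R := by
  have h : ∀ z : ℂ, 0 < z.im → HasSum (fun n : ℕ => (b n - a n) * qParam 1 z ^ n)
      ((Q - R).eval (etaQuot p z)) := fun z hz => by
    refine (congrArg₂ HasSum (funext fun n => ?_) ?_).mp ((hR z hz).sub (hQ z hz))
    · ring
    · rw [Polynomial.eval_sub]
      ring
  have h1 := eq_const_of_tendsto_eval hp (tendsto_atImInfty_of_hasSum h)
  have h2 : (b 0 - a 0 : ℂ) = 0 := by
    simpa [hQ0, hR0, sub_eq_zero] using (congrArg (Polynomial.coeff · 0) h1).symm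
  rw [h2, Polynomial.C_0] at h1
  exact sub_eq_zero.mp h1

end

lemma hasPolarExpansion_iff {m : ℕ} {a : ℕ → ℂ} {F : ℂ → ℂ} :
    HasPolarExpansion m (fun τ => F τ) a ↔ PolarExp m a F :=
  ⟨fun h z hz => h ⟨z, hz⟩, fun h τ => h τ τ.im_pos⟩

theorem theorem2 (p : ℕ) (hp : p = 2 ∨ p = 3 ∨ p = 5 ∨ p = 7)
    (m α m' : ℕ) (hm : m = p ^ α * m') (hm' : ¬ p ∣ m') :
    (∃! f : ℍ → ℂ, IsBasisElement p m f) ∧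
    ∀ f : ℍ → ℂ, IsBasisElement p m f →
      ∃ a : ℕ → ℤ, HasPolarExpansion m f (fun n => (a n : ℂ)) ∧
        ∀ β : ℕ, α < β → ∀ n : ℕ, 1 ≤ n →
          (p = 2 → (2 : ℤ) ^ (3 * (β - α) + 8) ∣ a (2 ^ β * n)) ∧
          (p = 3 → (3 : ℤ) ^ (2 * (β - α) + 3) ∣ a (3 ^ β * n)) ∧
          (p = 5 → (5 : ℤ) ^ ((β - α) + 1) ∣ a (5 ^ β * n)) ∧
          (p = 7 → (7 : ℤ) ^ (β - α) ∣ a (7 ^ β * n)) := by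
  have hp' : IsLevel p := hp
  have hm1 : 1 ≤ m := by
    rw [hm]
    exact Nat.mul_pos (pow_pos hp'.prime.pos _)
      (Nat.pos_of_ne_zero fun h => hm' (h ▸ dvd_zero p))
  obtain ⟨Q, a, hdeg, hQ0, hQ⟩ := exists_polarExp hp' hm1
  set F : ℂ → ℂ := fun z => etaQuot p z ^ m - Polynomial.aeval (etaQuot p z) Q
  have hF : F = fun z => etaQuot p z ^ m -
      (Q.map (Int.castRingHom ℂ)).eval (etaQuot p z) := by
    simp only [F, aeval_eq_eval_map]
  have hbasis : IsBasisElement p m fun τ => F τ :=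
    ⟨⟨Q.map (Int.castRingHom ℂ), Polynomial.degree_map_le.trans_lt hdeg, by simp [hQ0],
      fun τ => congrFun hF τ⟩, _, hasPolarExpansion_iff.mpr hQ⟩
  have huniq : ∀ f, IsBasisElement p m f → f = fun τ : ℍ => F τ := by
    rintro f ⟨⟨R, -, hR0, hR⟩, b, hb⟩
    have hb' : PolarExp m b fun z => etaQuot p z ^ m - R.eval (etaQuot p z) :=
      hasPolarExpansion_iff.mp (by rwa [funext hR] at hb)
    have := eq_of_polarExp hp' hR0 (by simp [hQ0]) hb' (hF ▸ hQ)
    rw [funext hR, this, hF]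
    rfl
  refine ⟨⟨_, hbasis, huniq⟩, fun f hf => ?_⟩
  rw [huniq f hf]
  refine ⟨a, hasPolarExpansion_iff.mpr hQ, fun β hβ n hn => ?_⟩
  have hF' : PolarExp (p ^ α * m') (fun n => (a n : ℂ))
      fun z => Polynomial.aeval (etaQuot p z) (Polynomial.X ^ m - Q) := by
    simpa [← hm] using hQ
  -- Here k = β - α - 1 counts the applications of U_p after the pole is gone, so the exponent is
  -- `polarExp` + `gainExp`·(β - α - 1) + `scaleExp`, which is the stated one for each p.
  obtain ⟨k, rfl⟩ := Nat.exists_eq_add_of_lt hβ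
  have key := hF'.pow_dvd_coeff hp' α hm' (k := k) hn
  rw [show α + 1 + k = α + k + 1 by ring] at key
  rw [show α + k + 1 - α = k + 1 by omega]
  refine ⟨?_, ?_, ?_, ?_⟩ <;> rintro rfl <;>
    refine (pow_dvd_pow _ ?_).trans key <;> simp [polarExp, gainExp, scaleExp] <;> omega
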